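/- Let $\mathfrak H$ be a real separable Hilbert space with a complete orthonormal system $(e_i)$, and let $W=\{W(h):h\in\mathfrak H\}$ be an isonormal Gaussian process over $\mathfrak H$ on a probability space $(\Omega,\mathcal F,P)$ (a centered Gaussian family with $E[W(g)W(h)]=\langle g,h\rangle$). Let $I_2$ denote the double Wiener integral with respect to $W$, the continuous linear map on the symmetric tensor square $\mathfrak H^{\odot 2}$ with $I_2(h\otimes h)=W(h)^2-1$ for $\|h\|=1$. Let $D$ be the Malliavin derivative, $J_q$ the orthogonal projection of $L^2(\Omega)$ onto the $q$-th Wiener chaos, and $L^{-1}F=-\sum_{q\ge 1}\frac1q J_qF$. Set $\Gamma_0(F)=F$ and $\Gamma_i(F)=\langle DF,-DL^{-1}\Gamma_{i-1}(F)\rangle_{\mathfrak H}$ for $i\ge1$. Write $\kappa_r$ for the $r$-th cumulant. For $f,g\in\mathfrak H^{\otimes 2}$ put $f\otimes_1 g=\sum_i\langle f,e_i\rangle_{\mathfrak H}\otimes\langle g,e_i\rangle_{\mathfrak H}$ (contraction of the last variables), $f\otimes_1^{(1)}f=f$ and $f\otimes_1^{(p)}f=(f\otimes_1^{(p-1)}f)\otimes_1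 f$ for $p\ge 2$. Let $f_\infty\in\mathfrak H^{\odot 2}$ be such that the Hilbert--Schmidt operator $A_{f_\infty}:g\mapsto f_\infty\otimes_1 g$ on $\mathfrak H$ has exactly $k<\infty$ non-zero eigenvalues $\alpha_1,\dots,\alpha_k$, pairwise distinct and each of multiplicity one. Put $F_\infty=I_2(f_\infty)$, $P(x)=x\prod_{i=1}^k(x-\alpha_i)$ and $Q=P^2$. Let $F_n=I_2(f_n)$, $n\ge1$, with $f_n\in\mathfrak H^{\odot2}$. Then the following four statements are equivalent, as $n\to\infty$: (i) $F_n$ converges in law to $F_\infty$; (ii) $\kappa_r(F_n)\to\kappa_r(F_\infty)$ for all $2\le r\le k+1=\deg P$, and $\displaystyle\sum_{r=2}^{\deg Q}\frac{Q^{(r)}(0)}{r!}\,\frac{\kappa_r(F_n)}{2^{r-1}(r-1)!}\to0$; (a) $\kappa_r(F_n)\to\kappa_r(F_\infty)$ for all $2\le r\le k+1$, and $\displaystyle E\Big[\Big(\sum_{r=1}^{k+1}\frac{P^{(r)}(0)}{r!\,2^{r-1}}\big(\Gamma_{r-1}(F_n)-E[\Gamma_{r-1}(F_n)]\big)\Big)^2\Big]\to0$;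 (b) $\kappa_r(F_n)\to\kappa_r(F_\infty)$ for all $2\le r\le k+1$, and $\displaystyle\Big\|\sum_{r=1}^{\deg P}\frac{P^{(r)}(0)}{r!}\,f_n\otimes_1^{(r)}f_n\Big\|^2_{\mathfrak H^{\otimes2}}\to0$. -/

import Mathlib

open MeasureTheory ProbabilityTheory Filter Topology
open scoped TensorProduct ENNReal

noncomputable section

namespace Wiener

/-! ### The Hilbert tensor square, symmetric kernels, contractions -/

section Tensor

variable {H : Type*} [NormedAddCommGroup H] [InnerProductSpace ℝ H]

/-- The Hilbert space tensor product `H ⊗ H`: the completion of the algebraic tensor product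
for the inner product `⟪a ⊗ b, c ⊗ d⟫ = ⟪a, c⟫ * ⟪b, d⟫`. -/
abbrev HTensor (H : Type*) [NormedAddCommGroup H] [InnerProductSpace ℝ H] : Type _ :=
  UniformSpace.Completion (H ⊗[ℝ] H)

/-- The elementary tensor `a ⊗ b`. -/
def pureTensor (a b : H) : HTensor H := ((a ⊗ₜ[ℝ] b : H ⊗[ℝ] H) : HTensor H)

/-- The symmetric tensor square: the closed linear span of the tensors `h ⊗ h`. -/
def symTensor (H : Type*) [NormedAddCommGroup H] [InnerProductSpace ℝ H] :
    Submodule ℝ (HTensor H) :=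
  (Submodule.span ℝ (Set.range fun h : H => pureTensor h h)).topologicalClosure

/-- The bounded operator `h ↦ h ⊗ g`. -/
def tensorRight (g : H) : H →L[ℝ] HTensor H :=
  UniformSpace.Completion.toComplL ∘L (TensorProduct.mkL ℝ H H).flip g

lemma tensorRight_apply (g h : H) : tensorRight g h = pureTensor h g := rfl

lemma pureTensor_add_right (a b c : H) :
    pureTensor a (b + c) = pureTensor a b + pureTensor a c := by
  simp [pureTensor, TensorProduct.tmul_add, UniformSpace.Completion.coe_add]

lemma pureTensor_smul_right (r : ℝ) (a b : H) :
    pureTensor a (r • b) = r • pureTensor a b := by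
  simp [pureTensor, TensorProduct.tmul_smul, UniformSpace.Completion.coe_smul]

variable [CompleteSpace H]

/-- The Hilbert–Schmidt operator `A_f : g ↦ f ⊗₁ g` of a kernel `f`. The vector `A_f g` (contraction
of the last variable of `f` against `g`) is determined by `⟪A_f g, h⟫ = ⟪f, h ⊗ g⟫`. -/
def kernelOp (f : HTensor H) : H →ₗ[ℝ] H where
  toFun g := ContinuousLinearMap.adjoint (tensorRight g) f
  map_add' a b := by
    refine ext_inner_right ℝ fun h => ?_
    simp only [ContinuousLinearMap.adjoint_inner_left, inner_add_left, tensorRight_apply,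
      pureTensor_add_right, inner_add_right]
  map_smul' r a := by
    refine ext_inner_right ℝ fun h => ?_
    simp only [ContinuousLinearMap.adjoint_inner_left, inner_smul_left, tensorRight_apply,
      pureTensor_smul_right, inner_smul_right, RingHom.id_apply, conj_trivial]

lemma inner_kernelOp (f : HTensor H) (g h : H) :
    inner ℝ (kernelOp f g) h = inner ℝ f (pureTensor h g) := by
  simp [kernelOp, ContinuousLinearMap.adjoint_inner_left, tensorRight_apply]

/-- The contraction of order one, `f ⊗₁ g = ∑ i, ⟪f, e i⟫_H ⊗ ⟪g, e i⟫_H`, where `e` is a complete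
orthonormal system and `⟪f, e i⟫_H = kernelOp f (e i)`. -/
def contraction {ι : Type*} (e : HilbertBasis ι ℝ H) (f g : HTensor H) : HTensor H :=
  ∑' i, pureTensor (kernelOp f (e i)) (kernelOp g (e i))

/-- The iterated contractions `f ⊗₁^{(p)} f`, `p ≥ 1`: the first one is `f`, and
`f ⊗₁^{(p + 1)} f = (f ⊗₁^{(p)} f) ⊗₁ f`. The value at `p = 0` is irrelevant. -/
def iterContraction {ι : Type*} (e : HilbertBasis ι ℝ H) (f : HTensor H) : ℕ → HTensor H
  | 0 => 0
  | 1 => f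
  | p + 2 => contraction e (iterContraction e f (p + 1)) f

end Tensor

/-! ### Isonormal Gaussian processes and the second order multiple integral -/

variable {Ω : Type*} [MeasurableSpace Ω]
variable {H : Type*} [NormedAddCommGroup H] [InnerProductSpace ℝ H]

/-- `W` is an isonormal Gaussian process over `H`, defined on the probability space `(Ω, P)`. -/
structure IsIsonormal (W : H → Ω → ℝ) (P : Measure Ω) : Prop where
  isGaussianProcess : IsGaussianProcess W P
  integral_eq_zero : ∀ h, ∫ ω, W h ω ∂P = 0
  integral_mul : ∀ g h, ∫ ω, W g ω * W h ω ∂P = inner ℝ g h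

namespace IsIsonormal

variable {W : H → Ω → ℝ} {P : Measure Ω}

lemma memLp (hW : IsIsonormal W P) (h : H) {p : ℝ≥0∞} (hp : p ≠ ∞) : MemLp (W h) p P :=
  (hW.isGaussianProcess.hasGaussianLaw_eval h).memLp hp

lemma memLp_mul (hW : IsIsonormal W P) (a b : H) : MemLp (fun ω => W a ω * W b ω) 2 P := by
  have : ENNReal.HolderTriple 4 4 2 := ⟨by
    rw [← ENNReal.toReal_eq_toReal_iff' (by finiteness) (by finiteness)]
    rw [ENNReal.toReal_add (by finiteness) (by finiteness)]
    norm_num [ENNReal.toReal_inv]⟩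
  exact (hW.memLp b (p := 4) (by norm_num)).mul (hW.memLp a (p := 4) (by norm_num))

lemma integrable_mul (hW : IsIsonormal W P) (a b : H) : Integrable (fun ω => W a ω * W b ω) P :=
  (hW.memLp a (p := 2) (by norm_num)).integrable_mul (hW.memLp b (p := 2) (by norm_num))

lemma integrable_mul4 (hW : IsIsonormal W P) (a b c d : H) :
    Integrable (fun ω => (W a ω * W b ω) * (W c ω * W d ω)) P :=
  (hW.memLp_mul a b).integrable_mul (hW.memLp_mul c d)

/-- `W` is almost surely linear. -/
lemma ae_lin (hW : IsIsonormal W P) (r s : ℝ) (a b : H) :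
    W (r • a + s • b) =ᵐ[P] fun ω => r * W a ω + s * W b ω := by
  set c := r • a + s • b with hc
  have key : ∫ ω, (W c ω - (r * W a ω + s * W b ω)) ^ 2 ∂P = 0 := by
    have e : (fun ω => (W c ω - (r * W a ω + s * W b ω)) ^ 2) = fun ω =>
        W c ω * W c ω + (-2 * r) * (W c ω * W a ω) + (-2 * s) * (W c ω * W b ω)
        + (r * r) * (W a ω * W a ω) + (2 * r * s) * (W a ω * W b ω)
        + (s * s) * (W b ω * W b ω) := by
      funext ω; ring
    have i := fun x y => hW.integrable_mul x y
    rw [e, integral_add, integral_add, integral_add, integral_add, integral_add]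
    · simp only [integral_const_mul, hW.integral_mul]
      simp only [hc, inner_add_left, inner_add_right, inner_smul_left, inner_smul_right,
        conj_trivial, real_inner_comm b a]
      ring
    all_goals
      repeat' apply Integrable.add
      all_goals first | exact i _ _ | exact (i _ _).const_mul _
  have m : MemLp (fun ω => W c ω - (r * W a ω + s * W b ω)) 2 P :=
    (hW.memLp c (by norm_num)).sub
      (((hW.memLp a (by norm_num)).const_mul r).add ((hW.memLp b (by norm_num)).const_mul s))
  have h0 := (integral_eq_zero_iff_of_nonneg (fun ω => sq_nonneg _) m.integrable_sq).1 key
  filter_upwards [h0] with ω hω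
  have : W c ω - (r * W a ω + s * W b ω) = 0 := by simpa using hω
  linarith

lemma integral_pow_four (hW : IsIsonormal W P) (h : H) :
    ∫ ω, W h ω ^ 4 ∂P = 3 * (inner ℝ h h : ℝ) ^ 2 := by
  have hG := hW.isGaussianProcess.hasGaussianLaw_eval h
  have := hG.isProbabilityMeasure
  set v : ℝ := inner ℝ h h with hv
  have hv0 : 0 ≤ v := real_inner_self_nonneg
  have hlaw := hG.map_eq_gaussianReal
  have hvar : Var[W h; P] = v := by
    rw [variance_of_integral_eq_zero hG.aemeasurable (hW.integral_eq_zero h), hv,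
      ← hW.integral_mul h h]
    simp [pow_two]
  rw [hW.integral_eq_zero h, hvar] at hlaw
  have hmgf : mgf (W h) P = fun t => Real.exp (v * t ^ 2 / 2) := by
    funext t
    rw [mgf_gaussianReal hlaw t, Real.coe_toNNReal v hv0]
    simp
  have hint : integrableExpSet (W h) P = Set.univ := by
    ext t
    simp only [integrableExpSet, Set.mem_ofPred_eq, Set.mem_univ, iff_true]
    have := integrable_exp_mul_gaussianReal (μ := 0) (v := v.toNNReal) t
    rw [← hlaw] at this
    exact this.comp_aemeasurable hG.aemeasurable
  have h4 := iteratedDeriv_mgf_zero (X := W h) (μ := P) (by simp [hint]) 4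
  rw [hmgf] at h4
  have base : ∀ t : ℝ, HasDerivAt (fun t => Real.exp (v * t ^ 2 / 2))
      (v * t * Real.exp (v * t ^ 2 / 2)) t := by
    intro t
    have : HasDerivAt (fun t : ℝ => v * t ^ 2 / 2) (v * t) t := by
      have := (((hasDerivAt_pow 2 t).const_mul v).div_const 2)
      convert! this using 1
      norm_num
      ring
    convert! this.exp using 1
    ring
  have step : ∀ (p q : ℝ → ℝ), (∀ t, HasDerivAt p (q t) t) →
      deriv (fun t => p t * Real.exp (v * t ^ 2 / 2)) =
        fun t => (q t + v * t * p t) * Real.exp (v * t ^ 2 / 2) := by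
    intro p q hp
    funext t
    have := ((hp t).fun_mul (base t)).deriv
    rw [this]
    ring
  have d1 : deriv (fun t => Real.exp (v * t ^ 2 / 2)) =
      fun t => (v * t) * Real.exp (v * t ^ 2 / 2) := funext fun t => (base t).deriv
  have d2 : deriv (fun t => (v * t) * Real.exp (v * t ^ 2 / 2)) =
      fun t => (v + v ^ 2 * t ^ 2) * Real.exp (v * t ^ 2 / 2) := by
    rw [step (fun t => v * t) (fun _ => v) (fun t => by simpa using (hasDerivAt_id t).const_mul v)]
    funext t; ring
  have d3 : deriv (fun t => (v + v ^ 2 * t ^ 2) * Real.exp (v * t ^ 2 / 2)) =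
      fun t => (3 * v ^ 2 * t + v ^ 3 * t ^ 3) * Real.exp (v * t ^ 2 / 2) := by
    rw [step (fun t => v + v ^ 2 * t ^ 2) (fun t => v ^ 2 * (2 * t)) (fun t => by
      simpa using ((hasDerivAt_pow 2 t).const_mul (v ^ 2)).const_add v)]
    funext t; ring
  have d4 : deriv (fun t => (3 * v ^ 2 * t + v ^ 3 * t ^ 3) * Real.exp (v * t ^ 2 / 2)) 0 =
      3 * v ^ 2 := by
    rw [step (fun t => 3 * v ^ 2 * t + v ^ 3 * t ^ 3)
      (fun t => 3 * v ^ 2 + v ^ 3 * (3 * t ^ 2)) (fun t => by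
      simpa using ((hasDerivAt_id t).const_mul (3 * v ^ 2)).fun_add
        ((hasDerivAt_pow 3 t).const_mul (v ^ 3)))]
    simp
  rw [iteratedDeriv_succ', iteratedDeriv_succ', iteratedDeriv_succ', iteratedDeriv_one, d1, d2, d3,
    d4] at h4
  rw [h4]
  rfl

/-- Fourth order moments of an isonormal process. -/
lemma integral_mul4 (hW : IsIsonormal W P) (a b c d : H) :
    ∫ ω, (W a ω * W b ω) * (W c ω * W d ω) ∂P =
      inner ℝ a b * inner ℝ c d + inner ℝ a c * inner ℝ b d + inner ℝ a d * inner ℝ b c := by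
  have lin : ∀ r s t : ℝ, W (a + r • b + s • c + t • d) =ᵐ[P]
      fun ω => W a ω + r * W b ω + s * W c ω + t * W d ω := by
    intro r s t
    filter_upwards [hW.ae_lin 1 t (a + r • b + s • c) d, hW.ae_lin 1 s (a + r • b) c,
      hW.ae_lin 1 r a b] with ω h1 h2 h3
    simp only [one_smul, one_mul] at h1 h2 h3
    rw [h1, h2, h3]
  have mem : ∀ r s t : ℝ,
      Integrable (fun ω => (W a ω + r * W b ω + s * W c ω + t * W d ω) ^ 4) P := by
    intro r s t
    have := hW.integrable_mul4 (a + r • b + s • c + t • d) (a + r • b + s • c + t • d)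
      (a + r • b + s • c + t • d) (a + r • b + s • c + t • d)
    refine this.congr ?_
    filter_upwards [lin r s t] with ω h
    rw [h]; ring
  have val : ∀ r s t : ℝ,
      ∫ ω, (W a ω + r * W b ω + s * W c ω + t * W d ω) ^ 4 ∂P =
      3 * (inner ℝ (a + r • b + s • c + t • d) (a + r • b + s • c + t • d) : ℝ) ^ 2 := by
    intro r s t
    rw [← hW.integral_pow_four]
    refine integral_congr_ae ?_
    filter_upwards [lin r s t] with ω h
    rw [h]
  have e : (fun ω => (W a ω * W b ω) * (W c ω * W d ω)) = fun ω =>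
      (1 / 192) * (W a ω + 1 * W b ω + 1 * W c ω + 1 * W d ω) ^ 4
      + (-1 / 192) * (W a ω + 1 * W b ω + 1 * W c ω + (-1) * W d ω) ^ 4
      + (-1 / 192) * (W a ω + 1 * W b ω + (-1) * W c ω + 1 * W d ω) ^ 4
      + (1 / 192) * (W a ω + 1 * W b ω + (-1) * W c ω + (-1) * W d ω) ^ 4
      + (-1 / 192) * (W a ω + (-1) * W b ω + 1 * W c ω + 1 * W d ω) ^ 4
      + (1 / 192) * (W a ω + (-1) * W b ω + 1 * W c ω + (-1) * W d ω) ^ 4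
      + (1 / 192) * (W a ω + (-1) * W b ω + (-1) * W c ω + 1 * W d ω) ^ 4
      + (-1 / 192) * (W a ω + (-1) * W b ω + (-1) * W c ω + (-1) * W d ω) ^ 4 := by
    funext ω; ring
  rw [e, integral_add, integral_add, integral_add, integral_add, integral_add, integral_add,
    integral_add]
  · simp only [integral_const_mul, val]
    simp only [inner_add_left, inner_add_right, inner_smul_left, inner_smul_right, conj_trivial,
      real_inner_comm b a, real_inner_comm c a, real_inner_comm d a, real_inner_comm c b,
      real_inner_comm d b, real_inner_comm d c]
    ring
  all_goals
    repeat' apply Integrable.add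
    all_goals exact (mem _ _ _).const_mul _

lemma memLp_mul_sub (hW : IsIsonormal W P) (a b : H) :
    MemLp (fun ω => W a ω * W b ω - inner ℝ a b) 2 P := by
  have := hW.isGaussianProcess.isProbabilityMeasure
  exact (hW.memLp_mul a b).sub (memLp_const _)

/-- The random variable `W(a) W(b) - ⟪a, b⟫`. -/
def wick (hW : IsIsonormal W P) (a b : H) : Lp ℝ 2 P := (hW.memLp_mul_sub a b).toLp _

lemma coeFn_wick (hW : IsIsonormal W P) (a b : H) :
    hW.wick a b =ᵐ[P] fun ω => W a ω * W b ω - inner ℝ a b := MemLp.coeFn_toLp _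

lemma wick_lin_left (hW : IsIsonormal W P) (r s : ℝ) (a b c : H) :
    hW.wick (r • a + s • b) c = r • hW.wick a c + s • hW.wick b c := by
  refine Lp.ext ?_
  filter_upwards [hW.coeFn_wick (r • a + s • b) c, hW.coeFn_wick a c, hW.coeFn_wick b c,
    Lp.coeFn_add (r • hW.wick a c) (s • hW.wick b c), Lp.coeFn_smul r (hW.wick a c),
    Lp.coeFn_smul s (hW.wick b c), hW.ae_lin r s a b] with ω h1 h2 h3 h4 h5 h6 h7
  rw [h4, Pi.add_apply, h5, h6, Pi.smul_apply, Pi.smul_apply, h1, h2, h3, h7]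
  simp only [inner_add_left, inner_smul_left, conj_trivial, smul_eq_mul]
  ring

lemma wick_comm (hW : IsIsonormal W P) (a b : H) : hW.wick a b = hW.wick b a := by
  refine Lp.ext ?_
  filter_upwards [hW.coeFn_wick a b, hW.coeFn_wick b a] with ω h1 h2
  rw [h1, h2, real_inner_comm, mul_comm]

lemma wick_lin_right (hW : IsIsonormal W P) (r s : ℝ) (a b c : H) :
    hW.wick c (r • a + s • b) = r • hW.wick c a + s • hW.wick c b := by
  rw [hW.wick_comm, hW.wick_lin_left, hW.wick_comm a, hW.wick_comm b]

/-- The linear map `a ⊗ b ↦ W(a) W(b) - ⟪a, b⟫` on the algebraic tensor product. -/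
def wickMap (hW : IsIsonormal W P) : H ⊗[ℝ] H →ₗ[ℝ] Lp ℝ 2 P :=
  TensorProduct.lift (LinearMap.mk₂ ℝ hW.wick
    (fun a b c => by simpa using hW.wick_lin_left 1 1 a b c)
    (fun r a c => by simpa using hW.wick_lin_left r 0 a 0 c)
    (fun c a b => by simpa using hW.wick_lin_right 1 1 a b c)
    (fun r c a => by simpa using hW.wick_lin_right r 0 a 0 c))

lemma wickMap_tmul (hW : IsIsonormal W P) (a b : H) : hW.wickMap (a ⊗ₜ b) = hW.wick a b := rfl

lemma inner_wick (hW : IsIsonormal W P) (a b c d : H) :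
    inner ℝ (hW.wick a b) (hW.wick c d) = inner ℝ a c * inner ℝ b d + inner ℝ a d * inner ℝ b c := by
  have := hW.isGaussianProcess.isProbabilityMeasure
  rw [L2.inner_def]
  have e : ∫ ω, inner ℝ (hW.wick a b ω) (hW.wick c d ω) ∂P =
      ∫ ω, ((W a ω * W b ω) * (W c ω * W d ω) + (-inner ℝ c d) * (W a ω * W b ω)
        + (-inner ℝ a b) * (W c ω * W d ω) + inner ℝ a b * inner ℝ c d) ∂P := by
    refine integral_congr_ae ?_
    filter_upwards [hW.coeFn_wick a b, hW.coeFn_wick c d] with ω h1 h2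
    rw [h1, h2]
    simp only [RCLike.inner_apply, conj_trivial]
    ring
  have i4 := hW.integrable_mul4 a b c d
  have i1 := (hW.integrable_mul a b).const_mul (-inner ℝ c d)
  have i2 := (hW.integrable_mul c d).const_mul (-inner ℝ a b)
  rw [e, integral_add ((i4.fun_add i1).fun_add i2) (integrable_const _),
    integral_add (i4.fun_add i1) i2, integral_add i4 i1, hW.integral_mul4, integral_const_mul, integral_const_mul,
    hW.integral_mul, hW.integral_mul]
  simp
  ring

lemma inner_wickMap (hW : IsIsonormal W P) (s t : H ⊗[ℝ] H) :
    inner ℝ (hW.wickMap s) (hW.wickMap t) =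
      inner ℝ s t + inner ℝ s (TensorProduct.comm ℝ H H t) := by
  induction s with
  | zero => simp
  | add x y hx hy => simp only [map_add, inner_add_left, hx, hy]; ring
  | tmul a b =>
    induction t with
    | zero => simp
    | add x y hx hy => simp only [map_add, inner_add_right, hx, hy]; ring
    | tmul c d => simp [wickMap_tmul, inner_wick]

lemma norm_wickMap_le (hW : IsIsonormal W P) (t : H ⊗[ℝ] H) :
    ‖hW.wickMap t‖ ≤ √2 * ‖t‖ := by
  have h1 : ‖hW.wickMap t‖ ^ 2 ≤ 2 * ‖t‖ ^ 2 := by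
    rw [← real_inner_self_eq_norm_sq (hW.wickMap t), inner_wickMap,
      show inner ℝ t t = ‖t‖ ^ 2 from real_inner_self_eq_norm_sq t]
    have := real_inner_le_norm t (TensorProduct.comm ℝ H H t)
    rw [TensorProduct.norm_comm] at this
    nlinarith
  rw [← abs_of_nonneg (norm_nonneg (hW.wickMap t)), ← abs_of_nonneg
    (show 0 ≤ √2 * ‖t‖ by positivity)]
  refine sq_le_sq.1 ?_
  rw [mul_pow, Real.sq_sqrt (by norm_num)]
  exact h1

/-- The double Wiener integral `I₂`: the continuous linear map with
`I₂ (a ⊗ b) = W(a) W(b) - ⟪a, b⟫`. On symmetric kernels it is the unique continuous linear map with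
`I₂ (h ⊗ h) = H₂ (W h)` for every unit vector `h`. -/
def I₂ (hW : IsIsonormal W P) : HTensor H →L[ℝ] Lp ℝ 2 P :=
  hW.wickMap.extendOfNorm
    (UniformSpace.Completion.toComplL : H ⊗[ℝ] H →L[ℝ] HTensor H).toLinearMap

lemma I₂_coe (hW : IsIsonormal W P) (t : H ⊗[ℝ] H) : hW.I₂ (t : HTensor H) = hW.wickMap t :=
  LinearMap.extendOfNorm_eq (e := (UniformSpace.Completion.toComplL :
      H ⊗[ℝ] H →L[ℝ] HTensor H).toLinearMap) UniformSpace.Completion.denseRange_coe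
    ⟨√2, fun x => by
      simpa using hW.norm_wickMap_le x⟩ t

lemma I₂_pureTensor (hW : IsIsonormal W P) (a b : H) :
    hW.I₂ (pureTensor a b) =ᵐ[P] fun ω => W a ω * W b ω - inner ℝ a b := by
  rw [pureTensor, I₂_coe, wickMap_tmul]
  exact hW.coeFn_wick a b

end IsIsonormal

/-! ### Wiener chaoses and Malliavin operators -/

variable (W : H → Ω → ℝ) (P : Measure Ω)

/-- The `q`-th Wiener chaos (`q ≥ 1`): the closed linear subspace of `L²(Ω)` generated by the random
variables `H_q (W h)`, `‖h‖ = 1`, where `H_q` is the `q`-th (probabilists') Hermite polynomial. -/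
def chaos (q : ℕ) : Submodule ℝ (Lp ℝ 2 P) :=
  (Submodule.span ℝ {F : Lp ℝ 2 P | ∃ h : H, ‖h‖ = 1 ∧
    F =ᵐ[P] fun ω => Polynomial.aeval (W h ω) (Polynomial.hermite q)}).topologicalClosure

instance chaos_complete (q : ℕ) : CompleteSpace (chaos W P q) :=
  (Submodule.isClosed_topologicalClosure _).completeSpace_coe

/-- The orthogonal projection `J_q` on the `q`-th Wiener chaos. -/
def J (q : ℕ) : Lp ℝ 2 P →L[ℝ] Lp ℝ 2 P := (chaos W P q).starProjection

/-- The pseudo-inverse `L⁻¹ F = ∑_{q ≥ 1} -(1/q) J_q F` of the Ornstein–Uhlenbeck generator. -/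
def Linv (F : Lp ℝ 2 P) : Lp ℝ 2 P := ∑' q : ℕ, (-(1 / ((q : ℝ) + 1))) • J W P (q + 1) F

/-- The graph of the Malliavin derivative on smooth cylindrical random variables: all pairs of
`F = g (W φ₁, …, W φₙ)` and `DF = ∑ i, ∂ᵢ g (W φ₁, …, W φₙ) φᵢ`, where `g` is smooth and all its
derivatives have polynomial growth. -/
def cylinderGraph : Set (Lp ℝ 2 P × Lp H 2 P) :=
  {p | ∃ (n : ℕ) (φ : Fin n → H) (g : (Fin n → ℝ) → ℝ), g.HasTemperateGrowth ∧
    (p.1 =ᵐ[P] fun ω => g fun j => W (φ j) ω) ∧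
    (p.2 =ᵐ[P] fun ω => ∑ i, fderiv ℝ g (fun j => W (φ j) ω) (Pi.single i 1) • φ i)}

open Classical in
/-- The Malliavin derivative, as the closure of its restriction to cylindrical random variables: for
`F` in its domain `𝔻^{1,2}`, `malliavinD W P F` is the element `U` of `L²(Ω; H)` such that `(F, U)`
is in the closure of the graph. (It takes the value `0` outside the domain.) -/
def malliavinD (F : Lp ℝ 2 P) : Lp H 2 P :=
  if h : ∃ U : Lp H 2 P, (F, U) ∈ closure (cylinderGraph W P) then h.choose else 0

open Classical in
/-- The class in `L²(Ω)` of a square integrable random variable (`0` for other functions). -/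
def toL2 (X : Ω → ℝ) : Lp ℝ 2 P := if h : MemLp X 2 P then h.toLp X else 0

/-- The random variables `Γ_i(F)`, as elements of `L²(Ω)`: `Γ₀(F) = F` and
`Γ_{i+1}(F) = ⟪DF, -D L⁻¹ Γ_i(F)⟫_H`. -/
def Gam (F : Lp ℝ 2 P) : ℕ → Lp ℝ 2 P
  | 0 => F
  | i + 1 => toL2 P fun ω =>
      inner ℝ (malliavinD W P F ω) (-(malliavinD W P (Linv W P (Gam F i)) ω))

/-! ### Cumulants and the polynomial of the target -/

/-- The `j`-th cumulant `κ_j(F) = (-i)^j (d/dt)^j log φ_F(t) |_{t = 0}`, where `φ_F` is the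
characteristic function of `F`. (For `F` with enough moments this number is real.) -/
def cumulant (j : ℕ) (F : Ω → ℝ) : ℝ :=
  ((-Complex.I) ^ j *
    iteratedDeriv j (fun t : ℝ => Complex.log (charFun (P.map F) t)) 0).re

/-- The polynomial `P(x) = x ∏ i, (x - α i)`. -/
def polyP {k : ℕ} (α : Fin k → ℝ) : Polynomial ℝ :=
  Polynomial.X * ∏ i, (Polynomial.X - Polynomial.C (α i))

/-- The polynomial `Q(x) = P(x)²`. -/
def polyQ {k : ℕ} (α : Fin k → ℝ) : Polynomial ℝ := polyP α ^ 2

/-- The coefficient `p^{(r)}(0) / r!`. -/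
def taylorCoeff (p : Polynomial ℝ) (r : ℕ) : ℝ :=
  ((Polynomial.derivative^[r] p).eval 0) / (r.factorial : ℝ)

end Wiener

end

/-! A symmetric kernel has a compact self-adjoint operator, so f = ∑ l_j v_j ⊗ v_j in some
orthonormal basis, with ∑ l_j² = ‖f‖², and I₂(f) = ∑ l_j (W(v_j)² - 1) with independent standard
normal W(v_j). All four conditions thus concern spectra only. The characteristic function is exp ∑
psi(t l_j) (`charFun_I₂`). The cumulant of order r ≥ 2 is 2^(r-1) (r-1)! ∑ l_j^r (`cumulant_I₂`).
The quantities required to vanish in the last three conditions are ∑ Q(l_j), 2 ∑ Q(l_j) and ∑ Q(l_j)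
(`sum_coeff_mul_cumulant_I₂`, `integral_sum_Gam_sq`, `norm_sq_sum_iterContraction`), so these
conditions coincide. For the second of them, `exists_Gam_eq` computes Γ_r as a constant plus 2^r I₂
of an iterated contraction; this rests on the closability of the Malliavin derivative, a consequence
of Gaussian integration by parts.

From laws to power sums (`tendsto_tsum_pow_of_tendsto_exp`): the modulus of the characteristic
function to the power -4 is ∏ (1 + 4 t² l_j²) ≥ 1 + 4 t² ∑ l_j², so convergence at t = 1 bounds ∑
l_j² uniformly in n. Near t = 0 one may then take logarithms, which are power series in t with the
power sums as coefficients up to fixed factors; compactness gives convergence of each coefficient.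
Finally ∑ Q(l_j) tends to its value at the limit, which is 0 because Q vanishes on the limiting
spectrum.

From power sums to laws (`tendsto_exp_of_tendsto_tsum_pow`): write psi(t x) = x² g(x) with g
bounded, and let L of degree < k interpolate g at the α_i. The sum of l_j² L(l_j) involves only
power sums of orders 2 to k + 1. On a bounded interval |g - L| ≤ ε + C ∏ (x - α_i)², and multiplying
by x² turns this into ε x² + C Q(x), whose sum over the spectrum is small. The factor x² absorbs the
eigenvalues accumulating at 0. -/

namespace Wiener

universe u

/-! ### Kernels as Hilbert–Schmidt operators, diagonalisation and contractions. -/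

section Tensor

variable {H : Type*} [NormedAddCommGroup H] [InnerProductSpace ℝ H]

lemma inner_pureTensor (a b c d : H) :
    inner ℝ (pureTensor a b) (pureTensor c d) = inner ℝ a c * inner ℝ b d := by
  simp [pureTensor, UniformSpace.Completion.inner_coe]

lemma norm_pureTensor (a b : H) : ‖pureTensor a b‖ = ‖a‖ * ‖b‖ := by
  simp [pureTensor, UniformSpace.Completion.norm_coe]

lemma pureTensor_smul_left (r : ℝ) (a b : H) :
    pureTensor (r • a) b = r • pureTensor a b := by
  simp [pureTensor, ← TensorProduct.smul_tmul', UniformSpace.Completion.coe_smul]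

/-- A closed subspace of `H ⊗ H` containing the elementary tensors is everything. -/
lemma mem_of_pureTensor_mem (K : Submodule ℝ (HTensor H)) (hK : IsClosed (K : Set (HTensor H)))
    (h : ∀ a b : H, pureTensor a b ∈ K) (f : HTensor H) : f ∈ K := by
  induction f using UniformSpace.Completion.induction_on with
  | hp => exact hK
  | ih t =>
    induction t with
    | zero => rw [UniformSpace.Completion.coe_zero]; exact K.zero_mem
    | tmul a b => exact h a b
    | add x y hx hy => rw [UniformSpace.Completion.coe_add]; exact K.add_mem hx hy

lemma ext_of_inner_pureTensor {f g : HTensor H}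
    (h : ∀ a b : H, inner ℝ f (pureTensor a b) = inner ℝ g (pureTensor a b)) : f = g := by
  refine ext_inner_right ℝ fun x => ?_
  have := mem_of_pureTensor_mem
    (LinearMap.ker (innerSL ℝ (f - g) : HTensor H →L[ℝ] ℝ).toLinearMap)
    (ContinuousLinearMap.isClosed_ker _) (fun a b => by simp [h a b]) x
  simpa [inner_sub_left, sub_eq_zero] using this

/-- A closed subspace of `H ⊗ H` containing the tensors `h ⊗ h` contains the symmetric kernels. -/
lemma symTensor_le {K : Submodule ℝ (HTensor H)} (hK : IsClosed (K : Set (HTensor H)))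
    (h : ∀ a : H, pureTensor a a ∈ K) : symTensor H ≤ K :=
  Submodule.topologicalClosure_minimal _ (Submodule.span_le.2 (by rintro _ ⟨a, rfl⟩; exact h a)) hK

lemma pureTensor_self_mem (a : H) : pureTensor a a ∈ symTensor H :=
  Submodule.le_topologicalClosure _ (Submodule.subset_span ⟨a, rfl⟩)

lemma isClosed_symTensor : IsClosed (symTensor H : Set (HTensor H)) :=
  Submodule.isClosed_topologicalClosure _

lemma inner_pureTensor_comm {f : HTensor H} (hf : f ∈ symTensor H) (a b : H) :
    inner ℝ f (pureTensor a b) = inner ℝ f (pureTensor b a) := by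
  have := symTensor_le
    (K := LinearMap.ker (innerSL ℝ (pureTensor a b - pureTensor b a) :
      HTensor H →L[ℝ] ℝ).toLinearMap)
    (ContinuousLinearMap.isClosed_ker _)
    (fun c => by simp [inner_pureTensor, mul_comm]) hf
  rw [real_inner_comm, real_inner_comm (pureTensor b a) f]
  simpa [inner_sub_left, sub_eq_zero] using this

/-- The tensors `v i ⊗ v j` of the vectors of a Hilbert basis are orthonormal. -/
lemma orthonormal_pureTensor {J : Type*} (v : HilbertBasis J ℝ H) :
    Orthonormal ℝ (fun p : J × J => pureTensor (v p.1) (v p.2)) := by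
  classical
  rw [orthonormal_iff_ite]
  rintro ⟨i, j⟩ ⟨i', j'⟩
  simp only [inner_pureTensor, orthonormal_iff_ite.1 v.orthonormal, Prod.mk.injEq]
  split_ifs <;> simp_all

lemma mem_symTensor_of_hasSum_diag {J : Type*} {v : J → H} {l : J → ℝ} {f : HTensor H}
    (hf : HasSum (fun j => l j • pureTensor (v j) (v j)) f) : f ∈ symTensor H :=
  isClosed_symTensor.mem_of_tendsto hf (Eventually.of_forall fun _ =>
    Submodule.sum_mem _ fun _ _ => Submodule.smul_mem _ _ (pureTensor_self_mem _))

variable [CompleteSpace H]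

lemma kernelOp_pureTensor (a b g : H) : kernelOp (pureTensor a b) g = inner ℝ b g • a := by
  refine ext_inner_right ℝ fun h => ?_
  rw [inner_kernelOp, inner_pureTensor, inner_smul_left]
  simp [mul_comm]

/-- Pairing `kernelOp f g` with itself and applying Cauchy–Schwarz yields the square of its norm on
the left. -/
lemma norm_kernelOp_le (f : HTensor H) (g : H) : ‖kernelOp f g‖ ≤ ‖f‖ * ‖g‖ := by
  have h := real_inner_le_norm f (pureTensor (kernelOp f g) g)
  rw [← inner_kernelOp, real_inner_self_eq_norm_sq, norm_pureTensor] at h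
  rcases (norm_nonneg (kernelOp f g)).eq_or_lt with h0 | h0
  · rw [← h0]; positivity
  · nlinarith

/-- The map sending a kernel to its bounded operator. -/
noncomputable def kernelCLM : HTensor H →L[ℝ] H →L[ℝ] H :=
  LinearMap.mkContinuous₂ (LinearMap.mk₂ ℝ (fun f g => kernelOp f g)
    (fun f f' g => by
      refine ext_inner_right ℝ fun h => ?_
      simp [inner_add_left, inner_kernelOp])
    (fun r f g => by
      refine ext_inner_right ℝ fun h => ?_
      simp [inner_smul_left, inner_kernelOp])
    (fun f g g' => map_add _ _ _) (fun r f g => map_smul _ _ _)) 1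
    (fun f g => by simpa using norm_kernelOp_le f g)

lemma kernelCLM_apply (f : HTensor H) (g : H) : kernelCLM f g = kernelOp f g := rfl

/-- Compact operators form a closed subspace, the kernel-to-operator map is continuous, and
elementary tensors give operators of rank at most one. -/
lemma isCompactOperator_kernelOp (f : HTensor H) : IsCompactOperator (kernelOp f) := by
  have := mem_of_pureTensor_mem
    ((compactOperator (RingHom.id ℝ) H H).comap (kernelCLM (H := H)).toLinearMap) ?_ ?_ f
  · exact this
  · exact (isClosed_setOfPred_isCompactOperator (𝕜₁ := ℝ) (𝕜₂ := ℝ) (σ₁₂ := RingHom.id ℝ)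
      (M₁ := H) (M₂ := H)).preimage kernelCLM.continuous
  · intro a b
    have h1 : IsCompactOperator (innerSL ℝ b : H →L[ℝ] ℝ) := by
      -- The `fun _` discards the piped preimage: the compact set is simply the closed unit ball of
      -- ℝ.
      refine ⟨(innerSL ℝ b) ⁻¹' Metric.closedBall 0 1 |> fun _ => Metric.closedBall 0 1,
        isCompact_closedBall 0 1, ?_⟩
      exact (innerSL ℝ b).continuous.continuousAt.preimage_mem_nhds
        (by simpa using Metric.closedBall_mem_nhds (0 : ℝ) one_pos)
    have h2 := h1.clm_comp (ContinuousLinearMap.toSpanSingleton ℝ a)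
    have h3 : (fun g => kernelOp (pureTensor a b) g) =
        ContinuousLinearMap.toSpanSingleton ℝ a ∘ (innerSL ℝ b : H →L[ℝ] ℝ) := by
      funext g
      simp [kernelOp_pureTensor]
    exact (h3 ▸ h2 : IsCompactOperator fun g => kernelOp (pureTensor a b) g)

lemma isSymmetric_kernelOp {f : HTensor H} (hf : f ∈ symTensor H) :
    (kernelOp f).IsSymmetric := by
  intro a b
  rw [inner_kernelOp, real_inner_comm (kernelOp f b) a, inner_kernelOp, inner_pureTensor_comm hf]

/-- The elements of `H` are determined by their inner products with a Hilbert basis. -/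
lemma _root_.HilbertBasis.ext_inner {E J : Type*} [NormedAddCommGroup E] [InnerProductSpace ℝ E]
    (v : HilbertBasis J ℝ E) {x y : E} (h : ∀ j, inner ℝ (v j) x = inner ℝ (v j) y) : x = y := by
  apply v.repr.injective
  ext j
  simpa [HilbertBasis.repr_apply_apply] using h j

/-- The matrix entries determine the operator on each basis vector, hence everywhere by continuity
and density of the span. -/
lemma eq_of_inner_basis {J : Type*} (v : HilbertBasis J ℝ H) {f g : HTensor H}
    (h : ∀ i j, inner ℝ f (pureTensor (v i) (v j)) = inner ℝ g (pureTensor (v i) (v j))) :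
    f = g := by
  have h1 : ∀ j, kernelOp f (v j) = kernelOp g (v j) := fun j => v.ext_inner fun i => by
    rw [real_inner_comm (kernelOp f (v j)), inner_kernelOp, real_inner_comm (kernelOp g (v j)),
      inner_kernelOp, h]
  refine ext_of_inner_pureTensor fun a b => ?_
  rw [← inner_kernelOp, ← inner_kernelOp]
  congr 1
  have h2 : kernelCLM f = kernelCLM g := by
    refine ContinuousLinearMap.ext_on
      (Submodule.dense_iff_topologicalClosure_eq_top.2 v.dense_span) ?_
    rintro _ ⟨j, rfl⟩
    exact h1 j
  exact congrArg (· b) h2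

/-- The Hilbert basis of `H ⊗ H` made of the tensors `v i ⊗ v j`. -/
noncomputable def tensorBasis {J : Type*} (v : HilbertBasis J ℝ H) :
    HilbertBasis (J × J) ℝ (HTensor H) :=
  HilbertBasis.mkOfOrthogonalEqBot (orthonormal_pureTensor v) (by
    rw [Submodule.eq_bot_iff]
    intro f hf
    refine eq_of_inner_basis v fun i j => ?_
    rw [inner_zero_left, real_inner_comm]
    exact hf _ (Submodule.subset_span ⟨(i, j), rfl⟩))

lemma tensorBasis_apply {J : Type*} (v : HilbertBasis J ℝ H) (p : J × J) :
    tensorBasis v p = pureTensor (v p.1) (v p.2) := by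
  simp [tensorBasis]

lemma _root_.HilbertBasis.hasSum_inner_sq {E J : Type*} [NormedAddCommGroup E]
    [InnerProductSpace ℝ E] (v : HilbertBasis J ℝ E) (x : E) :
    HasSum (fun j => inner ℝ x (v j) ^ 2) (‖x‖ ^ 2) := by
  have := v.hasSum_inner_mul_inner x x
  rw [real_inner_self_eq_norm_sq] at this
  refine this.congr_fun fun j => ?_
  rw [real_inner_comm x (v j), pow_two]

lemma hasSum_diag_of_inner {J : Type*} [DecidableEq J] (v : HilbertBasis J ℝ H) (l : J → ℝ)
    {f : HTensor H}
    (h : ∀ i j, inner ℝ f (pureTensor (v i) (v j)) = if i = j then l i else 0) :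
    HasSum (fun j => l j • pureTensor (v j) (v j)) f := by
  have h1 := (tensorBasis v).hasSum_repr f
  have hinj : Function.Injective (fun j : J => (j, j)) := fun a b hab => (Prod.mk.inj hab).1
  rw [← hinj.hasSum_iff] at h1
  · refine h1.congr_fun fun j => ?_
    simp [HilbertBasis.repr_apply_apply, tensorBasis_apply, real_inner_comm f, h]
  · rintro ⟨i, j⟩ hij
    have : i ≠ j := fun e => hij ⟨i, by simp [e]⟩
    simp [HilbertBasis.repr_apply_apply, tensorBasis_apply, real_inner_comm f, h, this]

section Diagonal

variable {J : Type*} {v : HilbertBasis J ℝ H} {l : J → ℝ} {f : HTensor H}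

lemma inner_of_hasSum_diag [DecidableEq J]
    (hf : HasSum (fun j => l j • pureTensor (v j) (v j)) f) (i j : J) :
    inner ℝ f (pureTensor (v i) (v j)) = if i = j then l i else 0 := by
  have h1 := hf.mapL (innerSL ℝ (pureTensor (v i) (v j)))
  rw [real_inner_comm]
  refine h1.unique ?_
  convert! hasSum_ite_eq i (if i = j then l i else 0) using 2 with k
  simp only [map_smul, innerSL_apply_apply, inner_pureTensor, smul_eq_mul,
    orthonormal_iff_ite.1 v.orthonormal]
  by_cases hki : k = i
  · subst hki
    by_cases hij : k = j
    · simp [hij]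
    · simp [hij, Ne.symm hij]
  · simp [hki, Ne.symm hki]

lemma kernelOp_of_hasSum_diag (hf : HasSum (fun j => l j • pureTensor (v j) (v j)) f) (j : J) :
    kernelOp f (v j) = l j • v j := by
  classical
  refine v.ext_inner fun i => ?_
  rw [real_inner_comm, inner_kernelOp, inner_of_hasSum_diag hf, inner_smul_right,
    orthonormal_iff_ite.1 v.orthonormal]
  split_ifs with hij
  · rw [hij, mul_one]
  · rw [mul_zero]

/-- Parseval in the tensor basis, where only diagonal coefficients survive. This is the source of
every square-summability hypothesis on a spectrum below. -/
lemma hasSum_sq_of_hasSum_diag (hf : HasSum (fun j => l j • pureTensor (v j) (v j)) f) :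
    HasSum (fun j => l j ^ 2) (‖f‖ ^ 2) := by
  classical
  have h1 := (tensorBasis v).hasSum_inner_sq f
  have hinj : Function.Injective (fun j : J => (j, j)) := fun a b hab => (Prod.mk.inj hab).1
  rw [← hinj.hasSum_iff] at h1
  · refine h1.congr_fun fun j => ?_
    rw [Function.comp_apply, tensorBasis_apply, inner_of_hasSum_diag hf, if_pos rfl]
  · rintro ⟨i, j⟩ hij
    have : i ≠ j := fun e => hij ⟨i, by simp [e]⟩
    simp [tensorBasis_apply, inner_of_hasSum_diag hf, this]

lemma summable_norm_kernelOp_sq {ι : Type*} (e : HilbertBasis ι ℝ H) (f : HTensor H) :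
    Summable (fun i => ‖kernelOp f (e i)‖ ^ 2) := by
  have h1 := ((tensorBasis e).hasSum_inner_sq f).summable.prod_symm.prod
  refine h1.congr fun i => ?_
  rw [← (e.hasSum_inner_sq (kernelOp f (e i))).tsum_eq]
  simp [tensorBasis_apply, inner_kernelOp]

/-- The `tsum` defining the contraction really converges: by ab ≤ a² + b², its terms are dominated
by two convergent Hilbert–Schmidt sums. -/
lemma hasSum_contraction {ι : Type*} (e : HilbertBasis ι ℝ H) (f g : HTensor H) :
    HasSum (fun i => pureTensor (kernelOp f (e i)) (kernelOp g (e i))) (contraction e f g) := by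
  refine Summable.hasSum (Summable.of_norm_bounded
    ((summable_norm_kernelOp_sq e f).add (summable_norm_kernelOp_sq e g)) fun i => ?_)
  rw [norm_pureTensor]
  nlinarith [sq_nonneg (‖kernelOp f (e i)‖ - ‖kernelOp g (e i)‖),
    sq_nonneg ‖kernelOp f (e i)‖, sq_nonneg ‖kernelOp g (e i)‖]

/-- Contraction is composition of operators, so eigenvalues multiply in a common eigenbasis.
Parseval in `e` removes the dependence on the basis used to contract. -/
lemma hasSum_diag_contraction {ι : Type*} (e : HilbertBasis ι ℝ H) {m : J → ℝ} {g : HTensor H}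
    (hf : HasSum (fun j => l j • pureTensor (v j) (v j)) f)
    (hg : HasSum (fun j => m j • pureTensor (v j) (v j)) g) :
    HasSum (fun j => (l j * m j) • pureTensor (v j) (v j)) (contraction e f g) := by
  classical
  refine hasSum_diag_of_inner v _ fun a b => ?_
  have sym : ∀ {l : J → ℝ} {f : HTensor H},
      HasSum (fun j => l j • pureTensor (v j) (v j)) f →
      ∀ a i, inner ℝ (v a) (kernelOp f (e i)) = l a * inner ℝ (v a) (e i) := by
    intro l f hf a i
    rw [← isSymmetric_kernelOp (mem_symTensor_of_hasSum_diag hf), kernelOp_of_hasSum_diag hf,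
      real_inner_smul_left]
  rw [real_inner_comm]
  refine ((hasSum_contraction e f g).mapL (innerSL ℝ (pureTensor (v a) (v b)))).unique ?_
  have h2 := (e.hasSum_inner_mul_inner (v a) (v b)).mul_left (l a * m b)
  rw [orthonormal_iff_ite.1 v.orthonormal] at h2
  convert! h2 using 1
  · funext i
    simp only [innerSL_apply_apply, inner_pureTensor, sym hf, sym hg, real_inner_comm (v b) (e i)]
    ring
  · split_ifs with hab <;> simp [hab]

lemma hasSum_diag_iterContraction {ι : Type*} (e : HilbertBasis ι ℝ H)
    (hf : HasSum (fun j => l j • pureTensor (v j) (v j)) f) (r : ℕ) :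
    HasSum (fun j => (l j ^ (r + 1)) • pureTensor (v j) (v j)) (iterContraction e f (r + 1)) := by
  induction r with
  | zero => simpa [iterContraction] using hf
  | succ r ih =>
    simp only [pow_succ _ (r + 1)]
    exact hasSum_diag_contraction e ih hf

end Diagonal

/-- The spectral theorem: a symmetric kernel is diagonal in some Hilbert basis. -/
theorem exists_hasSum_diag {H : Type u} [NormedAddCommGroup H] [InnerProductSpace ℝ H]
    [CompleteSpace H] {f : HTensor H} (hf : f ∈ symTensor H) :
    ∃ (J : Type u) (v : HilbertBasis J ℝ H) (l : J → ℝ),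
      HasSum (fun j => l j • pureTensor (v j) (v j)) f := by
  classical
  have hs := isSymmetric_kernelOp hf
  have hbot := ContinuousLinearMap.orthogonalComplement_iSup_eigenspaces_eq_bot
    (T := kernelCLM f) (isCompactOperator_kernelOp f) hs
  set E : ℝ → Submodule ℝ H := fun x => Module.End.eigenspace (kernelOp f) x with hE
  have hcl : ∀ x, IsClosed (E x : Set H) := fun x => by
    have : (E x : Set H) = {g | kernelCLM f g = x • g} := by
      ext g
      simp [hE, kernelCLM_apply]
    rw [this]
    exact isClosed_eq (kernelCLM f).continuous (continuous_const_smul x)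
  have : ∀ x, CompleteSpace (E x) := fun x => (hcl x).completeSpace_coe
  -- A Hilbert basis of every eigenspace, kernel included. Eigenspaces of a symmetric operator are
  -- orthogonal, and compactness makes their span dense, so the union is a Hilbert basis of `H`.
  choose w b hb using fun x => exists_hilbertBasis ℝ (E x)
  have hon : Orthonormal ℝ fun a : Σ x, w x => ((b a.1 a.2 : E a.1) : H) :=
    hs.orthogonalFamily_eigenspaces.orthonormal_sigma_orthonormal
      (v_family := fun x => b x) (fun x => (b x).orthonormal)
  have hspan : (Submodule.span ℝ (Set.range fun a : Σ x, w x => ((b a.1 a.2 : E a.1) : H)))ᗮ = ⊥ := by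
    rw [Submodule.eq_bot_iff]
    intro g hg
    have hg2 : g ∈ (⨆ x, E x)ᗮ := by
      rw [← Submodule.iInf_orthogonal, Submodule.mem_iInf]
      intro x u hu
      have h1 := ((b x).hasSum_repr ⟨u, hu⟩).mapL ((innerSL ℝ g).comp (E x).subtypeL)
      rw [real_inner_comm]
      refine h1.unique ?_
      convert! hasSum_zero using 2 with i
      have := hg _ (Submodule.subset_span ⟨⟨x, i⟩, rfl⟩)
      rw [real_inner_comm] at this
      simp [this]
    rw [show (⨆ x, E x)ᗮ = ⊥ from hbot] at hg2
    simpa using hg2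
  refine ⟨_, HilbertBasis.mkOfOrthogonalEqBot hon hspan, fun a => a.1,
    hasSum_diag_of_inner _ _ fun i j => ?_⟩
  rw [← inner_kernelOp]
  simp only [HilbertBasis.coe_mkOfOrthogonalEqBot]
  have h1 := Module.End.mem_eigenspace_iff.1 (b j.1 j.2).2
  have h2 := orthonormal_iff_ite.1 hon j i
  rw [h1, real_inner_smul_left, h2]
  by_cases hij : i = j
  · rw [if_pos hij, if_pos hij.symm, mul_one, hij]
  · rw [if_neg hij, if_neg (Ne.symm hij), mul_zero]

/-- If the non-zero eigenvalues of `kernelOp f` are the distinct simple values `α i`, sums over the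
spectrum of functions vanishing at `0` are sums over the `α i`. -/
lemma hasSum_comp_eigenvalues {J : Type*} {v : HilbertBasis J ℝ H} {l : J → ℝ} {f : HTensor H}
    (hf : HasSum (fun j => l j • pureTensor (v j) (v j)) f)
    {k : ℕ} {α : Fin k → ℝ} (hα_inj : Function.Injective α)
    (hα : ∀ x : ℝ, (x ≠ 0 ∧ Module.End.HasEigenvalue (kernelOp f) x) ↔ ∃ i, α i = x)
    (hα_simple : ∀ i, Module.finrank ℝ (Module.End.eigenspace (kernelOp f) (α i)) = 1)
    {E : Type*} [AddCommMonoid E] [TopologicalSpace E] (h : ℝ → E) (h0 : h 0 = 0) :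
    HasSum (fun j => h (l j)) (∑ i, h (α i)) := by
  classical
  have hmem : ∀ j, v j ∈ Module.End.eigenspace (kernelOp f) (l j) := fun j =>
    Module.End.mem_eigenspace_iff.2 (kernelOp_of_hasSum_diag hf j)
  have hne : ∀ j, v j ≠ 0 := fun j => v.orthonormal.ne_zero j
  have hs := isSymmetric_kernelOp (mem_symTensor_of_hasSum_diag hf)
  have hex : ∀ i, ∃ j, l j = α i := by
    intro i
    obtain ⟨u, hu, hu0⟩ := ((hα (α i)).2 ⟨i, rfl⟩).2.exists_hasEigenvector
    -- If no `l j` equals `α i`, symmetry makes an eigenvector for `α i` orthogonal to every `v j`,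
    -- hence zero.
    by_contra! hc
    refine hu0 (v.ext_inner fun j => ?_)
    have h1 := hs (v j) u
    rw [kernelOp_of_hasSum_diag hf, Module.End.mem_eigenspace_iff.1 hu, real_inner_smul_left,
      real_inner_smul_right] at h1
    rw [inner_zero_right]
    by_contra h2
    exact hc j (mul_right_cancel₀ h2 h1)
  choose σ hσ using hex
  have hσi : Function.Injective σ := fun a b hab => hα_inj (by rw [← hσ, ← hσ, hab])
  have huniq : ∀ j i, l j = α i → j = σ i := by
    intro j i hji
    -- Simplicity: two orthonormal vectors cannot lie in one line. So each `α i` is hit exactly once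
    -- and all other `l j` are 0.
    by_contra hj
    obtain ⟨c, hc⟩ := (finrank_eq_one_iff_of_nonzero'
      (⟨v (σ i), hσ i ▸ hmem (σ i)⟩ : Module.End.eigenspace (kernelOp f) (α i))
      (fun h => hne _ (congrArg Subtype.val h))).1 (hα_simple i) ⟨v j, hji ▸ hmem j⟩
    have hc' : c • v (σ i) = v j := congrArg Subtype.val hc
    have h1 := orthonormal_iff_ite.1 v.orthonormal j j
    have h2 := orthonormal_iff_ite.1 v.orthonormal (σ i) j
    rw [if_neg (Ne.symm hj)] at h2
    nth_rw 1 [← hc'] at h1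
    rw [real_inner_smul_left, h2] at h1
    simp at h1
  have hzero : ∀ j, j ∉ Set.range σ → h (l j) = 0 := by
    intro j hj
    by_cases hl : l j = 0
    · rw [hl, h0]
    · obtain ⟨i, hi⟩ := (hα (l j)).1
        ⟨hl, Module.End.hasEigenvalue_of_hasEigenvector ⟨hmem j, hne j⟩⟩
      exact absurd ⟨i, (huniq j i hi.symm).symm⟩ hj
  rw [← hσi.hasSum_iff hzero]
  convert! hasSum_fintype (fun i => h (α i)) using 2 with i
  simp [hσ]

end Tensor
end Wiener

namespace Wiener

/-! ### The exponent `psi`, cumulants, and recovery of power sums from characteristic functions. -/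

section Analysis

/-- The logarithm of the characteristic function of `N ^ 2 - 1` for a standard normal `N`. -/
noncomputable def psi (x : ℝ) : ℂ :=
  -(1 / 2) * Complex.log (1 - 2 * Complex.I * x) - Complex.I * x

lemma one_sub_mem_slitPlane (x : ℝ) : 1 - 2 * Complex.I * x ∈ Complex.slitPlane :=
  Or.inl (by simp)

lemma norm_one_sub (x : ℝ) : ‖1 - 2 * Complex.I * x‖ = √(1 + 4 * x ^ 2) := by
  rw [Complex.norm_eq_sqrt_sq_add_sq]
  simp
  ring_nf

lemma psi_zero : psi 0 = 0 := by simp [psi]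

lemma hasDerivAt_psi (x : ℝ) : HasDerivAt psi (-2 * x / (1 - 2 * Complex.I * x)) x := by
  have h0 : (1 - 2 * Complex.I * x) ≠ 0 := Complex.slitPlane_ne_zero (one_sub_mem_slitPlane x)
  have h1 : HasDerivAt (fun x : ℝ => (x : ℂ)) 1 x := Complex.ofRealCLM.hasDerivAt
  have h2 : HasDerivAt (fun x : ℝ => 1 - 2 * Complex.I * x) (-(2 * Complex.I * 1)) x :=
    (h1.const_mul (2 * Complex.I)).const_sub 1
  have h3 := ((h2.clog_real (one_sub_mem_slitPlane x)).const_mul (-(1 / 2))).sub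
    (h1.const_mul Complex.I)
  refine h3.congr_deriv ?_
  field_simp
  linear_combination (2 * x : ℂ) * Complex.I_sq

/-- Since |1 - 2iy| ≥ 1, the derivative of `psi` is at most 2|y|. The bound is quadratic for all x
because centring removes the linear term; it makes ∑ psi(t l_j) converge for every square-summable
spectrum. -/
lemma norm_psi_le (x : ℝ) : ‖psi x‖ ≤ 2 * x ^ 2 := by
  have h := (convex_uIcc 0 x).norm_image_sub_le_of_norm_hasDerivWithin_le (f := psi)
    (C := 2 * |x|) (fun y _ => (hasDerivAt_psi y).hasDerivWithinAt) (fun y hy => ?_)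
    Set.left_mem_uIcc Set.right_mem_uIcc
  · rw [psi_zero, sub_zero, sub_zero, Real.norm_eq_abs] at h
    nlinarith [sq_abs x]
  · have hy' : |y| ≤ |x| := by
      have := Set.abs_sub_left_of_mem_uIcc hy
      simpa using this
    rw [norm_div, norm_one_sub, norm_mul, Complex.norm_real, norm_neg, Real.norm_eq_abs]
    have h1 : 1 ≤ √(1 + 4 * y ^ 2) := Real.one_le_sqrt.2 (by nlinarith [sq_nonneg y])
    calc _ ≤ ‖(2 : ℂ)‖ * |y| := div_le_self (by positivity) h1
      _ ≤ 2 * |x| := by simpa using hy'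

lemma continuous_psi : Continuous psi :=
  continuous_iff_continuousAt.2 fun x => (hasDerivAt_psi x).continuousAt

lemma re_psi (x : ℝ) : (psi x).re = -(1 / 4) * Real.log (1 + 4 * x ^ 2) := by
  have h : (psi x).re = -(1 / 2) * (Complex.log (1 - 2 * Complex.I * x)).re := by
    simp [psi]
  rw [h, Complex.log_re, norm_one_sub, Real.log_sqrt (by positivity)]
  ring

lemma hasSum_psi {x : ℝ} (hx : 2 * |x| < 1) :
    HasSum (fun r : ℕ => 1 / 2 * (2 * Complex.I * x) ^ (r + 2) / (r + 2)) (psi x) := by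
  have h1 := Complex.hasSum_taylorSeries_neg_log (z := 2 * Complex.I * x) (by simpa using hx)
  -- Half the order-one term of -log(1 - z) at z = 2ix is ix, exactly the term subtracted in `psi`.
  have h2 := ((hasSum_nat_add_iff' 2).2 h1).mul_left (1 / 2 : ℂ)
  convert! h2 using 1
  · funext r
    push_cast
    ring
  · simp [psi, Finset.sum_range_succ]
    ring

/-- Coefficients of a power series in a real variable with complex values. -/
lemma iteratedDeriv_of_hasSum {f : ℝ → ℂ} {a : ℕ → ℂ}
    (h : ∀ᶠ t : ℝ in 𝓝 0, HasSum (fun n => (t : ℂ) ^ n * a n) (f t)) (n : ℕ) :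
    iteratedDeriv n f 0 = n.factorial * a n := by
  let p : FormalMultilinearSeries ℝ ℝ ℂ := fun n => ContinuousMultilinearMap.mkPiRing ℝ (Fin n) (a n)
  have hp : HasFPowerSeriesAt f p 0 := by
    rw [hasFPowerSeriesAt_iff]
    filter_upwards [h] with t ht
    rw [zero_add]
    convert! ht using 2 with n
    simp [p, FormalMultilinearSeries.coeff]
  obtain ⟨r, hr⟩ := hp
  have := hr.factorial_smul (1 : ℝ) n
  rw [iteratedDeriv_eq_iteratedFDeriv, ← this]
  simp [p]

section Spectrum

variable {J : Type*} {l : J → ℝ} {s : ℝ}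

lemma sq_le_of_hasSum (hl : HasSum (fun j => l j ^ 2) s) (j : J) : l j ^ 2 ≤ s :=
  le_hasSum hl j fun _ _ => sq_nonneg _

lemma abs_le_sqrt_of_hasSum (hl : HasSum (fun j => l j ^ 2) s) (j : J) : |l j| ≤ √s :=
  Real.abs_le_sqrt (sq_le_of_hasSum hl j)

lemma abs_pow_le_of_hasSum (hl : HasSum (fun j => l j ^ 2) s) (r : ℕ) (j : J) :
    |l j ^ (r + 2)| ≤ √s ^ r * l j ^ 2 := by
  rw [pow_add, abs_mul, abs_pow, abs_of_nonneg (sq_nonneg (l j))]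
  gcongr
  exact abs_le_sqrt_of_hasSum hl j

lemma summable_pow (hl : HasSum (fun j => l j ^ 2) s) (r : ℕ) :
    Summable (fun j => l j ^ (r + 2)) :=
  Summable.of_norm_bounded (hl.summable.mul_left (√s ^ r)) (abs_pow_le_of_hasSum hl r)

lemma abs_tsum_pow_le (hl : HasSum (fun j => l j ^ 2) s) (r : ℕ) :
    |∑' j, l j ^ (r + 2)| ≤ √s ^ (r + 2) := by
  have hs : 0 ≤ s := hl.nonneg fun _ => sq_nonneg _
  have := tsum_of_norm_bounded (f := fun j => l j ^ (r + 2)) (hl.mul_left (√s ^ r))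
    (abs_pow_le_of_hasSum hl r)
  rw [pow_add, Real.sq_sqrt hs]
  exact this

lemma summable_psi (hl : HasSum (fun j => l j ^ 2) s) (t : ℝ) :
    Summable (fun j => psi (t * l j)) :=
  Summable.of_norm_bounded (hl.summable.mul_left (2 * t ^ 2)) fun j =>
    (norm_psi_le _).trans_eq (by ring)

lemma norm_tsum_psi_le (hl : HasSum (fun j => l j ^ 2) s) (t : ℝ) :
    ‖∑' j, psi (t * l j)‖ ≤ 2 * t ^ 2 * s :=
  tsum_of_norm_bounded (hl.mul_left (2 * t ^ 2)) fun j =>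
    (norm_psi_le _).trans_eq (by ring)

lemma one_add_sum_le_prod_one_add {a : J → ℝ} (ha : ∀ j, 0 ≤ a j) (S : Finset J) :
    1 + ∑ j ∈ S, a j ≤ ∏ j ∈ S, (1 + a j) := by
  classical
  induction S using Finset.induction_on with
  | empty => simp
  | insert j S hj ih =>
    rw [Finset.sum_insert hj, Finset.prod_insert hj]
    have := Finset.sum_nonneg fun i (_ : i ∈ S) => ha i
    nlinarith [ha j, mul_nonneg (ha j) this, mul_le_mul_of_nonneg_left ih (ha j)]

/-- The modulus of the characteristic function is controlled by the sum of the squares. -/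
lemma norm_exp_tsum_psi_le (hl : HasSum (fun j => l j ^ 2) s) (t : ℝ) :
    1 + 4 * t ^ 2 * s ≤ ‖Complex.exp (∑' j, psi (t * l j))‖ ^ (-4 : ℤ) := by
  have hsum := (summable_psi hl t).hasSum
  have h2 : HasSum (fun j => 4 * t ^ 2 * l j ^ 2) (4 * t ^ 2 * s) := hl.mul_left _
  refine le_of_tendsto_of_tendsto (h2.const_add 1) ((continuous_norm.tendsto _).comp
    ((Complex.continuous_exp.tendsto _).comp hsum) |>.zpow₀ (-4) (Or.inl (by simp)))
    (Eventually.of_forall fun S => ?_)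
  simp only [Function.comp_apply, Complex.exp_sum, norm_prod]
  rw [← Finset.prod_zpow]
  refine (one_add_sum_le_prod_one_add (fun _ => by positivity) S).trans_eq ?_
  refine Finset.prod_congr rfl fun j _ => ?_
  -- The modulus of exp psi(x) is (1 + 4x²)^(-1/4); the exponent -4 inverts it factor by factor.
  rw [Complex.norm_exp, re_psi, ← Real.rpow_intCast, ← Real.exp_mul]
  push_cast
  rw [show (-(1 / 4) * Real.log (1 + 4 * (t * l j) ^ 2)) * (-4 : ℝ) =
    Real.log (1 + 4 * (t * l j) ^ 2) by ring, Real.exp_log (by positivity)]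
  ring

/-- Expand each `psi` in its Taylor series and exchange the two sums. The double family is dominated
by `l j ^ 2` times a geometric sequence of ratio 2|t|√s. -/
lemma hasSum_tsum_psi (hl : HasSum (fun j => l j ^ 2) s) {t : ℝ} (ht : 2 * |t| * √s < 1) :
    HasSum (fun r : ℕ => 1 / 2 * (2 * Complex.I * t) ^ (r + 2) / (r + 2) *
      ((∑' j, l j ^ (r + 2) : ℝ) : ℂ)) (∑' j, psi (t * l j)) := by
  obtain ⟨F, hF⟩ : ∃ F : J × ℕ → ℂ, ∀ j r, F (j, r) =
      1 / 2 * (2 * Complex.I * ((t * l j : ℝ) : ℂ)) ^ (r + 2) / (r + 2) := 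
    ⟨fun p => 1 / 2 * (2 * Complex.I * ((t * l p.1 : ℝ) : ℂ)) ^ (p.2 + 2) / (p.2 + 2),
      fun _ _ => rfl⟩
  have hsF : Summable F := by
    have h1 : Summable (fun r : ℕ => (2 * |t|) ^ 2 * (2 * |t| * √s) ^ r) :=
      (summable_geometric_of_lt_one (by positivity) ht).mul_left _
    refine Summable.of_norm_bounded (hl.summable.mul_of_nonneg h1 (fun _ => sq_nonneg _)
      (fun _ => by positivity)) ?_
    rintro ⟨j, r⟩
    have e : ‖F (j, r)‖ = 1 / 2 * (2 * |t|) ^ (r + 2) * |l j ^ (r + 2)| / (r + 2) := by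
      have : ‖((r : ℂ) + 2)‖ = r + 2 := by
        rw [show ((r : ℂ) + 2) = ((r + 2 : ℕ) : ℂ) by push_cast; ring, Complex.norm_natCast]
        push_cast; ring
      simp only [hF, norm_div, norm_mul, norm_pow, this, Complex.norm_real, Complex.norm_I,
        Real.norm_eq_abs, abs_pow]
      simp [mul_pow]
      ring
    rw [e]
    have h2 := abs_pow_le_of_hasSum hl r j
    calc _ ≤ 1 / 2 * (2 * |t|) ^ (r + 2) * (√s ^ r * l j ^ 2) / 1 := by
          gcongr
          have : (0 : ℝ) ≤ r := Nat.cast_nonneg r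
          linarith
      _ ≤ 1 * (2 * |t|) ^ (r + 2) * (√s ^ r * l j ^ 2) / 1 := by
          gcongr; norm_num
      _ = _ := by
        simp only
        ring
  have hj : ∀ j, HasSum (fun r => F (j, r)) (psi (t * l j)) := fun j => by
    simp only [hF]
    refine hasSum_psi (lt_of_le_of_lt ?_ ht)
    rw [abs_mul, ← mul_assoc]
    gcongr
    exact abs_le_sqrt_of_hasSum hl j
  have h3 : HasSum (fun j => psi (t * l j)) (∑' p, F p) := hsF.hasSum.prod_fiberwise hj
  have h4 : ∀ r : ℕ, HasSum (fun j => F (j, r)) (1 / 2 * (2 * Complex.I * t) ^ (r + 2) / (r + 2) *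
      ((∑' j, l j ^ (r + 2) : ℝ) : ℂ)) := fun r => by
    have := (Complex.ofRealCLM.hasSum (summable_pow hl r).hasSum).mul_left
      (1 / 2 * (2 * Complex.I * t) ^ (r + 2) / (r + 2))
    refine this.congr_fun fun j => ?_
    simp only [hF, Complex.ofRealCLM_apply, Complex.ofReal_mul, Complex.ofReal_pow]
    ring
  rw [h3.tsum_eq]
  exact ((Equiv.prodComm ℕ J).hasSum_iff.2 hsF.hasSum).prod_fiberwise h4

lemma eventually_lt_one_of_mul (c : ℝ) : ∀ᶠ t in 𝓝 (0 : ℝ), 2 * |t| * c < 1 := by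
  have : Continuous fun t : ℝ => 2 * |t| * c := by fun_prop
  exact this.continuousAt.eventually (gt_mem_nhds (by simp))

/-- With |Im z| ≤ 1 < π/2 the principal logarithm inverts exp, and exp z has positive real part,
where the logarithm is continuous. -/
lemma log_exp_of_norm_le {z : ℂ} (hz : ‖z‖ ≤ 1) :
    Complex.log (Complex.exp z) = z ∧ Complex.exp z ∈ Complex.slitPlane := by
  have h1 := abs_le.1 ((Complex.abs_im_le_norm z).trans hz)
  have := Real.pi_gt_three
  refine ⟨Complex.log_exp (by linarith) (by linarith), Or.inl ?_⟩
  rw [Complex.exp_re]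
  exact mul_pos (Real.exp_pos _) (Real.cos_pos_of_mem_Ioo ⟨by linarith, by linarith⟩)

/-- The cumulants of a random variable in the second chaos. -/
lemma cumulant_eq_tsum_pow {Ω : Type*} [MeasurableSpace Ω] {P : Measure Ω} {F : Ω → ℝ}
    (hl : HasSum (fun j => l j ^ 2) s)
    (hF : ∀ t, charFun (P.map F) t = Complex.exp (∑' j, psi (t * l j))) (r : ℕ) :
    cumulant P (r + 2) F = 2 ^ (r + 1) * (r + 1).factorial * ∑' j, l j ^ (r + 2) := by
  set a : ℕ → ℂ := fun n => 1 / 2 * (2 * Complex.I) ^ n / n * ((∑' j, l j ^ n : ℝ) : ℂ) with ha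
  -- Orders 0 and 1 are replaced by zero: there `a` would involve ∑ 1 and ∑ l_j, which need not
  -- converge.
  set b : ℕ → ℂ := fun n => if n < 2 then 0 else a n with hb
  have h1 : ∀ᶠ t : ℝ in 𝓝 0, HasSum (fun n => (t : ℂ) ^ n * b n)
      (Complex.log (charFun (P.map F) t)) := by
    have hc : Continuous fun t : ℝ => 2 * t ^ 2 * s := by fun_prop
    filter_upwards [eventually_lt_one_of_mul √s,
      hc.continuousAt.eventually (ge_mem_nhds (by simp : 2 * (0 : ℝ) ^ 2 * s < 1))] with t ht ht2
    rw [hF, (log_exp_of_norm_le ((norm_tsum_psi_le hl t).trans ht2)).1, ← hasSum_nat_add_iff' 2]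
    convert! hasSum_tsum_psi hl ht using 1
    · funext n
      simp only [hb, ha, if_neg (show ¬ n + 2 < 2 by omega), mul_pow]
      push_cast
      ring
    · simp [hb, Finset.sum_range_succ]
  rw [cumulant, iteratedDeriv_of_hasSum h1]
  have hI : (-Complex.I) ^ (r + 2) * (2 * Complex.I) ^ (r + 2) = 2 ^ (r + 2) := by
    rw [← mul_pow]
    congr 1
    linear_combination (-2 : ℂ) * Complex.I_sq
  have e : (-Complex.I) ^ (r + 2) * (((r + 2).factorial : ℂ) * b (r + 2)) =
      ((2 ^ (r + 1) * (r + 1).factorial * ∑' j, l j ^ (r + 2) : ℝ) : ℂ) := by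
    simp only [hb, ha, if_neg (show ¬ r + 2 < 2 by omega)]
    have h0 : ((r + 2 : ℕ) : ℂ) ≠ 0 := by exact_mod_cast (by omega : r + 2 ≠ 0)
    rw [show (r + 2).factorial = (r + 2) * (r + 1).factorial from Nat.factorial_succ (r + 1)]
    push_cast at h0 ⊢
    field_simp
    linear_combination ((r + 1).factorial * ∑' j, (l j : ℂ) ^ (r + 2)) * hI
  rw [e, Complex.ofReal_re]

end Spectrum

/-- Pointwise convergence of power series with bounded coefficients implies convergence of the
coefficients. -/
lemma tendsto_coeff_of_tendsto {c : ℕ → ℕ → ℝ} {c' : ℕ → ℝ} (w : ℕ → ℂ) (hw0 : ∀ r, w r ≠ 0)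
    (hw : ∀ r, ‖w r‖ ≤ 1) (hc : ∀ n r, |c n r| ≤ 1) (hc' : ∀ r, |c' r| ≤ 1)
    (h : ∀ u : ℝ, |u| < 1 → Tendsto (fun n => ∑' r, (u : ℂ) ^ (r + 2) * (w r * c n r)) atTop
      (𝓝 (∑' r, (u : ℂ) ^ (r + 2) * (w r * c' r)))) (r : ℕ) :
    Tendsto (fun n => c n r) atTop (𝓝 (c' r)) := by
  -- The coefficient sequences live in a compact product. Summing the series is continuous
  -- (dominated by a geometric series) and injective (uniqueness of Taylor coefficients), hence an
  -- embedding, so convergence of the sums pulls back to convergence of the coefficients.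
  let X := ℕ → Set.Icc (-1 : ℝ) 1
  let U := {u : ℝ // |u| < 1}
  let Φ : X → U → ℂ := fun x u => ∑' r, ((u : ℝ) : ℂ) ^ (r + 2) * (w r * (x r : ℝ))
  have bound : ∀ (u : U) (x : X) r, ‖((u : ℝ) : ℂ) ^ (r + 2) * (w r * (x r : ℝ))‖ ≤ |(u : ℝ)| ^ (r + 2) := by
    intro u x r
    rw [norm_mul, norm_mul, norm_pow, Complex.norm_real, Complex.norm_real, Real.norm_eq_abs,
      Real.norm_eq_abs]
    have h1 : |(x r : ℝ)| ≤ 1 := abs_le.2 (x r).2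
    have h2 : ‖w r‖ * |(x r : ℝ)| ≤ 1 := mul_le_one₀ (hw r) (abs_nonneg _) h1
    exact mul_le_of_le_one_right (by positivity) h2
  have geo : ∀ u : U, Summable fun r : ℕ => |(u : ℝ)| ^ (r + 2) := fun u =>
    (summable_nat_add_iff 2).2 (summable_geometric_of_lt_one (abs_nonneg _) u.2)
  have hcont : Continuous Φ := continuous_pi fun u =>
    continuous_tsum (fun r => by fun_prop) (geo u) fun r x => bound u x r
  have hinj : Function.Injective Φ := by
    intro x y hxy
    let b : X → ℕ → ℂ := fun z n => if n < 2 then 0 else w (n - 2) * (z (n - 2) : ℝ)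
    have hball : ∀ᶠ t : ℝ in 𝓝 0, |t| < 1 :=
      continuous_abs.continuousAt.eventually (gt_mem_nhds (by simp))
    have key : ∀ z : X, ∀ t : ℝ, |t| < 1 → HasSum (fun n => (t : ℂ) ^ n * b z n)
        (∑' n, (t : ℂ) ^ (n + 2) * (w n * (z n : ℝ))) := by
      intro z t ht
      rw [← hasSum_nat_add_iff' 2]
      simpa [b, Finset.sum_range_succ] using
        (Summable.of_norm_bounded (geo ⟨t, ht⟩) (bound ⟨t, ht⟩ z)).hasSum
    have key1 := hball.mono (key x)
    have key2 : ∀ᶠ t : ℝ in 𝓝 0, HasSum (fun n => (t : ℂ) ^ n * b y n)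
        (∑' n, (t : ℂ) ^ (n + 2) * (w n * (x n : ℝ))) := by
      filter_upwards [hball] with t ht
      have := key y t ht
      rwa [show (∑' n, (t : ℂ) ^ (n + 2) * (w n * (y n : ℝ))) = _ from
        (congrFun hxy ⟨t, ht⟩).symm] at this
    funext n
    have h1 := (iteratedDeriv_of_hasSum key1 (n + 2)).symm.trans
      (iteratedDeriv_of_hasSum key2 (n + 2))
    have h2 := mul_left_cancel₀ (Nat.cast_ne_zero.2 (Nat.factorial_ne_zero (n + 2))) h1
    simp only [b, if_neg (show ¬ n + 2 < 2 by omega), Nat.add_sub_cancel] at h2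
    exact Subtype.ext (by exact_mod_cast mul_left_cancel₀ (hw0 n) h2)
  have hemb := (hcont.isClosedEmbedding hinj).isEmbedding.isInducing
  let x : ℕ → X := fun n r => ⟨c n r, abs_le.1 (hc n r)⟩
  let x' : X := fun r => ⟨c' r, abs_le.1 (hc' r)⟩
  have hx : Tendsto x atTop (𝓝 x') :=
    (hemb.tendsto_nhds_iff).2 (tendsto_pi_nhds.2 fun u => h u u.2)
  exact (continuous_subtype_val.tendsto _).comp ((tendsto_pi_nhds.1 hx) r)

/-- Dividing the power sums by powers of a common bound `B` places them in the compact cube used by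
`tendsto_coeff_of_tendsto`. -/
lemma abs_scaled_tsum_pow_le {J : Type*} {l : J → ℝ} {s B : ℝ}
    (hl : HasSum (fun j => l j ^ 2) s) (hB0 : 0 < B) (hB : √s ≤ B) (r : ℕ) :
    |(∑' j, l j ^ (r + 2)) / B ^ (r + 2)| ≤ 1 := by
  rw [abs_div, abs_of_pos (pow_pos hB0 _)]
  refine div_le_one_of_le₀ ((abs_tsum_pow_le hl r).trans ?_) (by positivity)
  gcongr

/-- The substitution t = u / (2B) turns (2it)^(r+2) into (iu/B)^(r+2), and |u| < 1 keeps t inside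
the domain of `hasSum_tsum_psi`. -/
lemma tsum_scaled_eq_tsum_psi {J : Type*} {l : J → ℝ} {s B : ℝ}
    (hl : HasSum (fun j => l j ^ 2) s) (hB0 : 0 < B) (hB : √s ≤ B) {u : ℝ} (hu : |u| < 1) :
    ∑' r : ℕ, (u : ℂ) ^ (r + 2) * (1 / 2 * Complex.I ^ (r + 2) / (r + 2) *
      (((∑' j, l j ^ (r + 2)) / B ^ (r + 2) : ℝ) : ℂ)) = ∑' j, psi (u / (2 * B) * l j) := by
  have hu' : 2 * |u / (2 * B)| * √s < 1 := by
    rw [abs_div, abs_of_pos (by positivity : 0 < 2 * B)]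
    calc 2 * (|u| / (2 * B)) * √s ≤ 2 * (|u| / (2 * B)) * B := by gcongr
      _ = |u| := by field_simp
      _ < 1 := hu
  rw [← (hasSum_tsum_psi hl hu').tsum_eq]
  refine tsum_congr fun r => ?_
  have hBc : (B : ℂ) ≠ 0 := by exact_mod_cast hB0.ne'
  have : ((r : ℂ) + 2) ≠ 0 := by exact_mod_cast (by omega : r + 2 ≠ 0)
  push_cast
  rw [mul_pow, mul_pow, div_pow, mul_pow]
  field_simp

/-- Convergence of the characteristic functions of elements of the second chaos implies convergence
of all power sums of the spectra. -/
theorem tendsto_tsum_pow_of_tendsto_exp {J : ℕ → Type*} {J' : Type*} {l : ∀ n, J n → ℝ}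
    {l' : J' → ℝ} {s : ℕ → ℝ} {s' : ℝ} (hl : ∀ n, HasSum (fun j => l n j ^ 2) (s n))
    (hl' : HasSum (fun j => l' j ^ 2) s')
    (h : ∀ t : ℝ, Tendsto (fun n => Complex.exp (∑' j, psi (t * l n j))) atTop
      (𝓝 (Complex.exp (∑' j, psi (t * l' j))))) (r : ℕ) :
    Tendsto (fun n => ∑' j, l n j ^ (r + 2)) atTop (𝓝 (∑' j, l' j ^ (r + 2))) := by
  -- Uniform bound on the Hilbert–Schmidt norms: at t = 1 the characteristic functions converge to a
  -- non-zero limit, so the -4 powers of their moduli are bounded, and these dominate 1 + 4 s n.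
  obtain ⟨M, hM0, hM, hM'⟩ : ∃ M : ℝ, 0 < M ∧ (∀ n, s n ≤ M) ∧ s' ≤ M := by
    have h1 := ((continuous_norm.tendsto _).comp (h 1)).zpow₀ (-4)
      (Or.inl (by simp))
    obtain ⟨B, hB⟩ := h1.bddAbove_range
    refine ⟨max (max B s') 1, by positivity, fun n => ?_, by simp⟩
    have h2 := norm_exp_tsum_psi_le (hl n) 1
    have h3 := hB ⟨n, rfl⟩
    have h4 : 0 ≤ s n := (hl n).nonneg fun _ => sq_nonneg _
    refine le_trans ?_ ((le_max_left B s').trans (le_max_left _ _))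
    simp only [Function.comp_apply] at h3
    linarith
  set B := √M with hB
  have hB0 : 0 < B := Real.sqrt_pos.2 hM0
  have hsB : ∀ {q}, q ≤ M → √q ≤ B := fun h => Real.sqrt_le_sqrt h
  have hlim : ∀ u : ℝ, |u| < 1 → Tendsto (fun n => ∑' j, psi (u / (2 * B) * l n j)) atTop
      (𝓝 (∑' j, psi (u / (2 * B) * l' j))) := by
    intro u hu
    have hsmall : ∀ {q}, q ≤ M → 2 * (u / (2 * B)) ^ 2 * q ≤ 1 := by
      intro q hq
      calc 2 * (u / (2 * B)) ^ 2 * q ≤ 2 * (u / (2 * B)) ^ 2 * B ^ 2 := by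
            gcongr
            rwa [hB, Real.sq_sqrt hM0.le]
        _ = u ^ 2 / 2 := by field_simp
        _ ≤ 1 := by nlinarith [sq_abs u, abs_nonneg u]
    have e1 := log_exp_of_norm_le ((norm_tsum_psi_le hl' (u / (2 * B))).trans (hsmall hM'))
    have e2 := (continuousAt_clog e1.2).tendsto.comp (h (u / (2 * B)))
    rw [e1.1] at e2
    refine e2.congr fun n => ?_
    exact (log_exp_of_norm_le ((norm_tsum_psi_le (hl n) (u / (2 * B))).trans (hsmall (hM n)))).1
  have h0 : ∀ r : ℕ, ((r : ℂ) + 2) ≠ 0 := fun r => by exact_mod_cast (by omega : r + 2 ≠ 0)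
  have := tendsto_coeff_of_tendsto (fun r : ℕ => 1 / 2 * Complex.I ^ (r + 2) / (r + 2))
    (fun r => by simp [h0 r]) (fun r => ?_)
    (fun n => abs_scaled_tsum_pow_le (hl n) hB0 (hsB (hM n)))
    (abs_scaled_tsum_pow_le hl' hB0 (hsB hM')) (fun u hu => ?_) r
  · have h2 := this.mul_const (B ^ (r + 2))
    simpa [div_mul_cancel₀ _ (pow_pos hB0 (r + 2)).ne'] using h2
  · have : ‖((r : ℂ) + 2)‖ = r + 2 := by
      rw [show ((r : ℂ) + 2) = ((r + 2 : ℕ) : ℂ) by push_cast; ring, Complex.norm_natCast]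
      push_cast; ring
    rw [norm_div, norm_mul, norm_pow, Complex.norm_I, this]
    have hr : (0 : ℝ) ≤ r := Nat.cast_nonneg r
    rw [div_le_one (by positivity)]
    norm_num
    linarith
  · rw [tsum_scaled_eq_tsum_psi hl' hB0 (hsB hM') hu]
    exact (hlim u hu).congr fun n => (tsum_scaled_eq_tsum_psi (hl n) hB0 (hsB (hM n)) hu).symm

end Analysis
end Wiener

namespace Wiener

/-! ### From finitely many power sums and `polyQ` to convergence of characteristic functions. -/

section PolynomialTest

lemma taylorCoeff_eq_coeff (p : Polynomial ℝ) (r : ℕ) : taylorCoeff p r = p.coeff r := by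
  rw [taylorCoeff, ← Polynomial.coeff_zero_eq_eval_zero, Polynomial.coeff_iterate_derivative,
    zero_add, Nat.descFactorial_self, nsmul_eq_mul,
    mul_div_cancel_left₀ _ (Nat.cast_ne_zero.2 (Nat.factorial_ne_zero r))]

lemma eval_polyP {k : ℕ} (α : Fin k → ℝ) (x : ℝ) :
    (polyP α).eval x = x * ∏ i, (x - α i) := by
  simp [polyP, Polynomial.eval_prod]

lemma natDegree_polyP {k : ℕ} (α : Fin k → ℝ) : (polyP α).natDegree = k + 1 := by
  rw [polyP, Polynomial.monic_X.natDegree_mul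
    (Polynomial.monic_prod_of_monic _ _ fun _ _ => Polynomial.monic_X_sub_C _),
    Polynomial.natDegree_prod_of_monic _ _ fun _ _ => Polynomial.monic_X_sub_C _]
  simp [add_comm]

lemma coeff_zero_polyP {k : ℕ} (α : Fin k → ℝ) : (polyP α).coeff 0 = 0 := by
  simp [polyP]

lemma eval_polyQ {k : ℕ} (α : Fin k → ℝ) (x : ℝ) :
    (polyQ α).eval x = (x * ∏ i, (x - α i)) ^ 2 := by
  simp [polyQ, eval_polyP]

lemma eval_polyQ_eq_zero {k : ℕ} (α : Fin k → ℝ) (i : Fin k) : (polyQ α).eval (α i) = 0 := by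
  rw [eval_polyQ, Finset.prod_eq_zero (Finset.mem_univ i) (sub_self _)]
  simp

/-- X² divides Q, so the sum of Q over a spectrum needs only power sums of order at least 2; ∑ l_j
itself may diverge. -/
lemma coeff_polyQ {k : ℕ} (α : Fin k → ℝ) {r : ℕ} (hr : r < 2) : (polyQ α).coeff r = 0 := by
  have : polyQ α = (∏ i, (Polynomial.X - Polynomial.C (α i))) ^ 2 * Polynomial.X ^ 2 := by
    rw [polyQ, polyP]; ring
  rw [this, Polynomial.coeff_mul_X_pow', if_neg (by omega)]

variable {J : Type*} {l : J → ℝ} {s : ℝ}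

lemma hasSum_eval (hl : HasSum (fun j => l j ^ 2) s) (p : Polynomial ℝ)
    (hp : ∀ r < 2, p.coeff r = 0) :
    HasSum (fun j => p.eval (l j))
      (∑ r ∈ Finset.Icc 2 p.natDegree, p.coeff r * ∑' j, l j ^ r) := by
  have e : ∀ x, p.eval x = ∑ r ∈ Finset.Icc 2 p.natDegree, p.coeff r * x ^ r := by
    intro x
    rw [Polynomial.eval_eq_sum_range]
    symm
    refine Finset.sum_subset (fun r hr => ?_) fun r hr hr' => ?_
    · simp at hr ⊢; omega
    · rw [hp r (by simp at hr hr'; omega), zero_mul]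
  simp only [e]
  refine hasSum_sum fun r hr => ?_
  obtain ⟨m, rfl⟩ : ∃ m, r = m + 2 := ⟨r - 2, by simp at hr; omega⟩
  exact (summable_pow hl m).hasSum.mul_left _

lemma eval_eq_sum_range_of_degree_lt {R : Type*} [CommSemiring R] {p : Polynomial R} {k : ℕ}
    (hp : p.degree < k) (x : R) : p.eval x = ∑ r ∈ Finset.range k, p.coeff r * x ^ r := by
  rw [Polynomial.eval_eq_sum, Polynomial.sum_def]
  refine Finset.sum_subset (fun r hr => ?_) fun r _ hr => ?_
  · have := (Polynomial.le_degree_of_mem_supp r hr).trans_lt hp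
    simpa using this
  · rw [Polynomial.notMem_support_iff.1 hr, zero_mul]

/-- A bounded function vanishing continuously at the zeros of `R` is dominated by `ε + C * R ^ 2` on
bounded intervals. -/
lemma exists_norm_le_add_mul_sq {k : ℕ} {α : Fin k → ℝ} {g : ℝ → ℂ} {R : ℝ → ℝ} {B C₀ ε : ℝ}
    (hε : 0 < ε) (hC₀ : 0 ≤ C₀) (hg : ∀ x ∈ Set.Icc (-B) B, ‖g x‖ ≤ C₀)
    (hcont : ∀ i, ContinuousAt g (α i)) (hzero : ∀ i, g (α i) = 0) (hR : Continuous R)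
    (hR0 : ∀ x, R x = 0 → ∃ i, x = α i) :
    ∃ C, 0 ≤ C ∧ ∀ x ∈ Set.Icc (-B) B, ‖g x‖ ≤ ε + C * R x ^ 2 := by
  -- Near the zeros of R the function is below ε; on the compact remainder R² ≥ δ > 0, which gives C
  -- = C₀ / δ. The interior is needed because g is continuous only at the α_i.
  set U := interior {x | ‖g x‖ < ε} with hU
  have hα : ∀ i, α i ∈ U := fun i => by
    rw [hU, mem_interior_iff_mem_nhds]
    exact (hcont i).norm.eventually (gt_mem_nhds (by simpa [hzero i] using hε))
  have hK : IsCompact (Set.Icc (-B) B \ U) := isCompact_Icc.diff isOpen_interior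
  obtain ⟨δ, hδ, hδ'⟩ := hK.exists_forall_le' (f := fun x => R x ^ 2) (hR.pow 2).continuousOn
    (a := 0) fun x hx => by
      have : R x ≠ 0 := fun h => by
        obtain ⟨i, rfl⟩ := hR0 x h
        exact hx.2 (hα i)
      positivity
  refine ⟨C₀ / δ, by positivity, fun x hx => ?_⟩
  by_cases hxU : x ∈ U
  · have h1 : x ∈ {x | ‖g x‖ < ε} := interior_subset (hU ▸ hxU)
    rw [Set.mem_ofPred_eq] at h1
    have h2 : 0 ≤ C₀ / δ * R x ^ 2 := by positivity
    linarith
  · have h1 := hδ' x ⟨hx, hxU⟩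
    calc ‖g x‖ ≤ C₀ := hg x hx
      _ = C₀ / δ * δ := by field_simp
      _ ≤ C₀ / δ * R x ^ 2 := by gcongr
      _ ≤ _ := by linarith

/-- If the first power sums of the spectra converge to those of `α` and the sums of the squares of
`x * ∏ i, (x - α i)` over the spectra vanish in the limit, then the sums of `x ^ 2 * g x` converge
for every bounded `g` which is continuous at the points `α i`. -/
theorem tendsto_tsum_sq_mul {J : ℕ → Type*} {l : ∀ n, J n → ℝ} {s : ℕ → ℝ}
    (hl : ∀ n, HasSum (fun j => l n j ^ 2) (s n)) {k : ℕ} {α : Fin k → ℝ}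
    (hα : Function.Injective α)
    (hpow : ∀ r < k, Tendsto (fun n => ∑' j, l n j ^ (r + 2)) atTop (𝓝 (∑ i, α i ^ (r + 2))))
    (hQ : Tendsto (fun n => ∑' j, (polyQ α).eval (l n j)) atTop (𝓝 0))
    {g : ℝ → ℂ} {C : ℝ} (hg : ∀ x, ‖g x‖ ≤ C) (hcont : ∀ i, ContinuousAt g (α i)) :
    Tendsto (fun n => ∑' j, (l n j : ℂ) ^ 2 * g (l n j)) atTop
      (𝓝 (∑ i, (α i : ℂ) ^ 2 * g (α i))) := by
  obtain ⟨M, hM0, hM⟩ : ∃ M : ℝ, 0 ≤ M ∧ ∀ n, s n ≤ M := by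
    have : Bornology.IsBounded (Set.range s) := by
      -- For k = 0 no power sum is assumed, but then Q = X² and `hQ` itself bounds the second-order
      -- sums.
      rcases Nat.eq_zero_or_pos k with rfl | hk
      · refine Metric.isBounded_range_of_tendsto s (hQ.congr fun n => ?_)
        rw [← (hl n).tsum_eq]
        simp [eval_polyQ]
      · exact Metric.isBounded_range_of_tendsto s ((hpow 0 hk).congr fun n => (hl n).tsum_eq)
    obtain ⟨B, hB⟩ := this.bddAbove
    exact ⟨max B 0, le_max_right _ _, fun n => (hB ⟨n, rfl⟩).trans (le_max_left _ _)⟩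
  -- Degree < k is what makes x² L(x) a combination of exactly the powers 2, …, k + 1 controlled by
  -- `hpow`.
  set L := Lagrange.interpolate Finset.univ (fun i => (α i : ℂ)) (fun i => g (α i)) with hL
  have hinj : Set.InjOn (fun i => (α i : ℂ)) (Finset.univ : Finset (Fin k)) :=
    fun a _ b _ hab => hα (Complex.ofReal_injective hab)
  have hLα : ∀ i, L.eval (α i : ℂ) = g (α i) := fun i =>
    Lagrange.eval_interpolate_at_node _ hinj (Finset.mem_univ i)
  have hLdeg : L.degree < k := by
    have := Lagrange.degree_interpolate_lt (fun i => g (α i)) hinj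
    rwa [Finset.card_univ, Fintype.card_fin] at this
  have hLeval := eval_eq_sum_range_of_degree_lt hLdeg
  have h1 : ∀ n, HasSum (fun j => (l n j : ℂ) ^ 2 * L.eval (l n j : ℂ))
      (∑ r ∈ Finset.range k, L.coeff r * ((∑' j, l n j ^ (r + 2) : ℝ) : ℂ)) := by
    intro n
    simp only [hLeval, Finset.mul_sum]
    refine hasSum_sum fun r _ => ?_
    have := (Complex.ofRealCLM.hasSum (summable_pow (hl n) r).hasSum).mul_left (L.coeff r)
    refine this.congr_fun fun j => ?_
    simp only [Complex.ofRealCLM_apply, Complex.ofReal_pow]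
    ring
  have h1lim : Tendsto (fun n => ∑ r ∈ Finset.range k,
      L.coeff r * ((∑' j, l n j ^ (r + 2) : ℝ) : ℂ)) atTop (𝓝 (∑ i, (α i : ℂ) ^ 2 * g (α i))) := by
    have e : ∑ i, (α i : ℂ) ^ 2 * g (α i) =
        ∑ r ∈ Finset.range k, L.coeff r * ((∑ i, α i ^ (r + 2) : ℝ) : ℂ) := by
      simp only [← hLα, hLeval]
      push_cast
      simp only [Finset.mul_sum]
      rw [Finset.sum_comm]
      refine Finset.sum_congr rfl fun r _ => Finset.sum_congr rfl fun i _ => by ring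
    rw [e]
    exact tendsto_finsetSum _ fun r hr => ((Complex.continuous_ofReal.tendsto _).comp
      (hpow r (Finset.mem_range.1 hr))).const_mul _
  set g₀ : ℝ → ℂ := fun x => g x - L.eval (x : ℂ) with hg₀
  have hmem : ∀ n j, l n j ∈ Set.Icc (-√M) √M := fun n j =>
    abs_le.1 ((abs_le_sqrt_of_hasSum (hl n) j).trans (Real.sqrt_le_sqrt (hM n)))
  have hLc : Continuous fun x : ℝ => L.eval (x : ℂ) := L.continuous.comp Complex.continuous_ofReal
  obtain ⟨C₁, hC₁⟩ := isCompact_Icc.exists_bound_of_continuousOn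
    (s := Set.Icc (-√M) √M) hLc.continuousOn
  have hg₀b : ∀ x ∈ Set.Icc (-√M) √M, ‖g₀ x‖ ≤ C + C₁ := fun x hx =>
    (norm_sub_le _ _).trans (add_le_add (hg x) (hC₁ x hx))
  have hC : 0 ≤ C + C₁ := (norm_nonneg _).trans
    (hg₀b 0 ⟨by simp, by simp⟩)
  have hsum₀ : ∀ n, Summable (fun j => (l n j : ℂ) ^ 2 * g₀ (l n j)) := fun n =>
    Summable.of_norm_bounded ((hl n).summable.mul_left (C + C₁)) fun j => by
      rw [norm_mul, norm_pow, Complex.norm_real, Real.norm_eq_abs, sq_abs, mul_comm]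
      gcongr
      exact hg₀b _ (hmem n j)
  have h2lim : Tendsto (fun n => ∑' j, (l n j : ℂ) ^ 2 * g₀ (l n j)) atTop (𝓝 0) := by
    rw [Metric.tendsto_nhds]
    intro ε hε
    -- Since s n ≤ M, the ε-term contributes at most ε/2; M + 1 keeps the denominator positive. With
    -- R = ∏ (x - α_i), x² R² is Q, so the other term is controlled by `hQ`.
    obtain ⟨D, hD0, hD⟩ := exists_norm_le_add_mul_sq (α := α) (g := g₀)
      (R := fun x => ∏ i, (x - α i)) (ε := ε / (2 * (M + 1))) (by positivity) hC hg₀b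
      (fun i => (hcont i).sub hLc.continuousAt) (fun i => by simp [hg₀, hLα]) (by fun_prop)
      (fun x hx => by
        obtain ⟨i, _, hi⟩ := Finset.prod_eq_zero_iff.1 hx
        exact ⟨i, sub_eq_zero.1 hi⟩)
    have hev : ∀ᶠ n in atTop, D * ∑' j, (polyQ α).eval (l n j) < ε / 2 := by
      have := hQ.const_mul D
      rw [mul_zero] at this
      exact this.eventually (gt_mem_nhds (by positivity))
    filter_upwards [hev] with n hn
    rw [dist_zero_right]
    have hQs := (hasSum_eval (hl n) (polyQ α) fun r hr => coeff_polyQ α hr).summable.hasSum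
    have hb := tsum_of_norm_bounded (f := fun j => (l n j : ℂ) ^ 2 * g₀ (l n j))
      (((hl n).mul_left (ε / (2 * (M + 1)))).add (hQs.mul_left D)) fun j => by
        rw [norm_mul, norm_pow, Complex.norm_real, Real.norm_eq_abs, sq_abs, eval_polyQ]
        nlinarith [mul_le_mul_of_nonneg_left (hD _ (hmem n j)) (sq_nonneg (l n j))]
    have h3 : ε / (2 * (M + 1)) * s n ≤ ε / 2 := by
      calc _ ≤ ε / (2 * (M + 1)) * (M + 1) := by
            gcongr
            linarith [hM n]
        _ = ε / 2 := by field_simp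
    linarith
  have h3 := h1lim.add h2lim
  rw [add_zero] at h3
  refine h3.congr fun n => ?_
  rw [← (h1 n).tsum_eq, ← (h1 n).summable.tsum_add (hsum₀ n)]
  refine tsum_congr fun j => ?_
  simp only [hg₀]
  ring

/-- The conditions on power sums imply convergence of the characteristic functions. -/
theorem tendsto_exp_of_tendsto_tsum_pow {J : ℕ → Type*} {l : ∀ n, J n → ℝ} {s : ℕ → ℝ}
    (hl : ∀ n, HasSum (fun j => l n j ^ 2) (s n)) {k : ℕ} {α : Fin k → ℝ}
    (hα : Function.Injective α) (hα0 : ∀ i, α i ≠ 0)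
    (hpow : ∀ r < k, Tendsto (fun n => ∑' j, l n j ^ (r + 2)) atTop (𝓝 (∑ i, α i ^ (r + 2))))
    (hQ : Tendsto (fun n => ∑' j, (polyQ α).eval (l n j)) atTop (𝓝 0)) (t : ℝ) :
    Tendsto (fun n => Complex.exp (∑' j, psi (t * l n j))) atTop
      (𝓝 (Complex.exp (∑ i, psi (t * α i)))) := by
  refine (Complex.continuous_exp.tendsto _).comp ?_
  have e : ∀ x : ℝ, (x : ℂ) ^ 2 * (psi (t * x) / (x : ℂ) ^ 2) = psi (t * x) := by
    intro x
    rcases eq_or_ne x 0 with rfl | hx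
    · simp [psi_zero]
    · have : (x : ℂ) ≠ 0 := by exact_mod_cast hx
      field_simp
  -- At x = 0 the quotient takes the value 0; continuity there is not required because all α_i are
  -- non-zero.
  have := tendsto_tsum_sq_mul hl hα hpow hQ (g := fun x => psi (t * x) / (x : ℂ) ^ 2)
    (C := 2 * t ^ 2) (fun x => ?_) fun i => ?_
  · simpa only [e] using this
  · rw [norm_div, norm_pow, Complex.norm_real, Real.norm_eq_abs, sq_abs]
    refine div_le_of_le_mul₀ (sq_nonneg x) (by positivity) ((norm_psi_le _).trans_eq (by ring))
  · have h0 : ((α i : ℝ) : ℂ) ^ 2 ≠ 0 := pow_ne_zero _ (by exact_mod_cast hα0 i)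
    exact ((continuous_psi.comp (continuous_const.mul continuous_id)).continuousAt).div
      ((Complex.continuous_ofReal.pow 2).continuousAt) h0

end PolynomialTest

end Wiener

namespace Wiener

/-! ### Characteristic functions of the second chaos and convergence in law. -/

section Law

variable {Ω : Type*} [MeasurableSpace Ω] {P : Measure Ω}

lemma integral_norm_le_norm_Lp [IsProbabilityMeasure P] {E : Type*} [NormedAddCommGroup E]
    (F : Lp E 2 P) : ∫ ω, ‖F ω‖ ∂P ≤ ‖F‖ := by
  rw [Lp.norm_def, integral_norm_eq_lintegral_enorm (Lp.aestronglyMeasurable F),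
    ← eLpNorm_one_eq_lintegral_enorm]
  exact ENNReal.toReal_mono (Lp.memLp F).eLpNorm_ne_top
    (eLpNorm_le_eLpNorm_of_exponent_le (by norm_num) (Lp.aestronglyMeasurable F))

lemma charFun_map_eq_integral {F : Ω → ℝ} (hF : AEMeasurable F P) (t : ℝ) :
    charFun (P.map F) t = ∫ ω, Complex.exp (Complex.I * (t * F ω : ℝ)) ∂P := by
  rw [charFun_apply_real, integral_map hF (by fun_prop)]
  refine integral_congr_ae (Eventually.of_forall fun ω => ?_)
  simp only
  congr 1
  push_cast
  ring

lemma norm_exp_sub_exp_le (a b : ℝ) :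
    ‖Complex.exp (Complex.I * (a : ℝ)) - Complex.exp (Complex.I * (b : ℝ))‖ ≤ ‖a - b‖ := by
  have e : Complex.exp (Complex.I * (a : ℝ)) - Complex.exp (Complex.I * (b : ℝ)) =
      Complex.exp (Complex.I * (b : ℝ)) * (Complex.exp (Complex.I * ((a - b : ℝ) : ℂ)) - 1) := by
    rw [mul_sub, ← Complex.exp_add, mul_one]
    congr 2
    push_cast
    ring
  rw [e, norm_mul, Complex.norm_exp_I_mul_ofReal, one_mul]
  exact Real.norm_exp_I_mul_ofReal_sub_one_le

/-- The characteristic function is continuous on `L²`. -/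
lemma continuous_charFun_Lp [IsProbabilityMeasure P] (t : ℝ) :
    Continuous fun F : Lp ℝ 2 P => charFun (P.map F) t := by
  have meas : ∀ F : Lp ℝ 2 P, AEStronglyMeasurable (F : Ω → ℝ) P := fun F =>
    Lp.aestronglyMeasurable F
  have int : ∀ F : Lp ℝ 2 P, Integrable (fun ω => Complex.exp (Complex.I * (t * F ω : ℝ))) P := by
    intro F
    refine Integrable.of_bound (C := 1) ?_ (Eventually.of_forall fun ω => ?_)
    · have := meas F
      fun_prop
    · rw [Complex.norm_exp_I_mul_ofReal]
  refine (LipschitzWith.of_dist_le_mul (K := ⟨|t|, abs_nonneg t⟩) fun F G => ?_).continuous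
  rw [charFun_map_eq_integral (meas F).aemeasurable, charFun_map_eq_integral (meas G).aemeasurable,
    dist_eq_norm, dist_eq_norm, ← integral_sub (int F) (int G)]
  have i2 : Integrable (fun ω => ‖(F - G : Lp ℝ 2 P) ω‖) P :=
    ((Lp.memLp (F - G)).integrable (by norm_num)).norm
  calc _ ≤ ∫ ω, ‖Complex.exp (Complex.I * (t * F ω : ℝ)) -
          Complex.exp (Complex.I * (t * G ω : ℝ))‖ ∂P := norm_integral_le_integral_norm _
    _ ≤ ∫ ω, |t| * ‖(F - G : Lp ℝ 2 P) ω‖ ∂P := by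
        refine integral_mono_ae ((int F).sub (int G)).norm (i2.const_mul _) ?_
        filter_upwards [Lp.coeFn_sub F G] with ω hω
        refine (norm_exp_sub_exp_le _ _).trans_eq ?_
        rw [← mul_sub, norm_mul, hω, Real.norm_eq_abs t, Pi.sub_apply]
    _ = |t| * ∫ ω, ‖(F - G : Lp ℝ 2 P) ω‖ ∂P := integral_const_mul _ _
    _ ≤ |t| * ‖F - G‖ := by gcongr; exact integral_norm_le_norm_Lp _

/-- A Gaussian integral with complex parameter (1 - 2is)/2. That parameter has positive real part,
so the square root is on the principal branch and agrees with the logarithm in `psi`. -/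
lemma integral_exp_sq_gaussian (s : ℝ) :
    ∫ x, Complex.exp (Complex.I * (s * (x ^ 2 - 1) : ℝ)) ∂(gaussianReal 0 1) =
      Complex.exp (psi s) := by
  have h0 : (1 - 2 * Complex.I * s) ≠ 0 := Complex.slitPlane_ne_zero (one_sub_mem_slitPlane s)
  have hpi : (0 : ℝ) < 2 * Real.pi := by positivity
  rw [integral_gaussianReal_eq_integral_smul (by norm_num)]
  have hb : 0 < ((1 - 2 * Complex.I * s) / 2).re := by
    rw [show (1 - 2 * Complex.I * s) / 2 = ((1 / 2 : ℝ) : ℂ) - Complex.I * s by push_cast; ring]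
    simp
  have e1 : ∀ x : ℝ, gaussianPDFReal 0 1 x • Complex.exp (Complex.I * (s * (x ^ 2 - 1) : ℝ)) =
      (((√(2 * Real.pi))⁻¹ : ℝ) * Complex.exp (-Complex.I * s)) *
        Complex.exp (-((1 - 2 * Complex.I * s) / 2) * (x : ℂ) ^ 2) := by
    intro x
    rw [gaussianPDFReal, Complex.real_smul]
    push_cast
    rw [mul_assoc, ← Complex.exp_add, mul_assoc _ (Complex.exp _) (Complex.exp _),
      ← Complex.exp_add]
    simp only [mul_one]
    congr 2
    ring
  simp only [e1]
  rw [integral_const_mul, integral_gaussian_complex hb,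
    show (Real.pi : ℂ) / ((1 - 2 * Complex.I * s) / 2) =
      ((2 * Real.pi : ℝ) : ℂ) * (1 - 2 * Complex.I * s)⁻¹ by push_cast; field_simp,
    Complex.cpow_def_of_ne_zero (mul_ne_zero (by exact_mod_cast hpi.ne') (inv_ne_zero h0)),
    Complex.log_ofReal_mul hpi (inv_ne_zero h0), Complex.log_inv _
      (Complex.slitPlane_arg_ne_pi (one_sub_mem_slitPlane s))]
  have e2 : (((√(2 * Real.pi))⁻¹ : ℝ) : ℂ) =
      Complex.exp (-(1 / 2) * (Real.log (2 * Real.pi) : ℝ)) := by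
    rw [show (-(1 / 2) * (Real.log (2 * Real.pi) : ℝ) : ℂ) =
      ((-(Real.log √(2 * Real.pi)) : ℝ) : ℂ) by rw [Real.log_sqrt hpi.le]; push_cast; ring,
      ← Complex.ofReal_exp, Real.exp_neg, Real.exp_log (Real.sqrt_pos.2 hpi)]
  rw [e2, ← Complex.exp_add, ← Complex.exp_add, psi]
  congr 1
  ring

variable {H : Type*} [NormedAddCommGroup H] [InnerProductSpace ℝ H]
  {W : H → Ω → ℝ}

namespace IsIsonormal

lemma map_eq_gaussianReal (hW : IsIsonormal W P) {h : H} (hh : ‖h‖ = 1) :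
    P.map (W h) = gaussianReal 0 1 := by
  have hG := hW.isGaussianProcess.hasGaussianLaw_eval h
  have := hG.isProbabilityMeasure
  have hvar : Var[W h; P] = 1 := by
    rw [variance_of_integral_eq_zero hG.aemeasurable (hW.integral_eq_zero h)]
    have := hW.integral_mul h h
    rw [real_inner_self_eq_norm_sq, hh] at this
    simpa [pow_two] using this
  have := hG.map_eq_gaussianReal
  rwa [hW.integral_eq_zero h, hvar, Real.toNNReal_one] at this

lemma covariance_eq_inner (hW : IsIsonormal W P) (g h : H) : cov[W g, W h; P] = inner ℝ g h := by
  have := hW.isGaussianProcess.isProbabilityMeasure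
  rw [covariance_eq_sub (hW.memLp g (by norm_num)) (hW.memLp h (by norm_num)),
    hW.integral_eq_zero, hW.integral_eq_zero, mul_zero, sub_zero, ← hW.integral_mul]
  rfl

lemma iIndepFun_orthonormal (hW : IsIsonormal W P) {J : Type*} {v : J → H} (hv : Orthonormal ℝ v)
    (S : Finset J) : iIndepFun (fun j : S => W (v j)) P := by
  have hG : IsGaussianProcess (W ∘ v) P := hW.isGaussianProcess.comp_right v
  refine (hG.hasGaussianLaw S).iIndepFun_of_covariance_eq_zero fun i j hij => ?_
  have h0 : inner ℝ (v i) (v j) = 0 := hv.2 fun h => hij (Subtype.ext h)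
  rw [← h0]
  exact hW.covariance_eq_inner _ _

/-- The characteristic function of a diagonal element of the second chaos. -/
theorem charFun_I₂ (hW : IsIsonormal W P) {J : Type*} {v : J → H} (hv : Orthonormal ℝ v)
    {l : J → ℝ} {f : HTensor H} {s : ℝ} (hl : HasSum (fun j => l j ^ 2) s)
    (hf : HasSum (fun j => l j • pureTensor (v j) (v j)) f) (t : ℝ) :
    charFun (P.map (hW.I₂ f)) t = Complex.exp (∑' j, psi (t * l j)) := by
  have := hW.isGaussianProcess.isProbabilityMeasure
  -- By L²-continuity of I₂ and of the characteristic function, finite partial sums suffice; for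
  -- these, independence factorises the expectation.
  have h1 : Tendsto (fun S : Finset J => charFun (P.map (hW.I₂ (∑ j ∈ S, l j •
      pureTensor (v j) (v j)))) t) atTop (𝓝 (charFun (P.map (hW.I₂ f)) t)) :=
    ((continuous_charFun_Lp t).tendsto _).comp ((hW.I₂.continuous.tendsto _).comp hf)
  have h2 : Tendsto (fun S : Finset J => Complex.exp (∑ j ∈ S, psi (t * l j))) atTop
      (𝓝 (Complex.exp (∑' j, psi (t * l j)))) :=
    (Complex.continuous_exp.tendsto _).comp (summable_psi hl t).hasSum
  refine tendsto_nhds_unique h1 (h2.congr fun S => ?_)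
  have hmeas : ∀ j, AEMeasurable (W (v j)) P := fun j => hW.isGaussianProcess.aemeasurable _
  have hae : hW.I₂ (∑ j ∈ S, l j • pureTensor (v j) (v j)) =ᵐ[P]
      fun ω => ∑ j ∈ S, l j * (W (v j) ω ^ 2 - 1) := by
    rw [map_sum]
    have h3 : ∀ j ∈ S, hW.I₂ (l j • pureTensor (v j) (v j)) =ᵐ[P]
        fun ω => l j * (W (v j) ω ^ 2 - 1) := by
      intro j _
      rw [map_smul]
      filter_upwards [hW.I₂_pureTensor (v j) (v j),
        Lp.coeFn_smul (l j) (hW.I₂ (pureTensor (v j) (v j)))] with ω h4 h5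
      rw [h5, Pi.smul_apply, h4, real_inner_self_eq_norm_sq, hv.1 j, smul_eq_mul]
      ring
    have h6 := (S.eventually_all (l := ae P)).2 h3
    filter_upwards [h6, Lp.coeFn_finsetSum S fun j => hW.I₂ (l j • pureTensor (v j) (v j))]
      with ω h7 h8
    rw [h8, Finset.sum_apply]
    exact Finset.sum_congr rfl h7
  rw [Measure.map_congr hae]
  have hind : iIndepFun (S.restrict fun j ω => l j * (W (v j) ω ^ 2 - 1)) P :=
    (hW.iIndepFun_orthonormal hv S).comp (fun j x => l j * (x ^ 2 - 1)) fun j => by fun_prop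
  rw [hind.charFun_map_fun_finsetSum_eq_prod (fun j _ => by have := hmeas j; fun_prop),
    Finset.prod_apply, Complex.exp_sum]
  refine Finset.prod_congr rfl fun j _ => ?_
  rw [charFun_map_eq_integral (by have := hmeas j; fun_prop), ← integral_exp_sq_gaussian,
    ← hW.map_eq_gaussianReal (hv.1 j), integral_map (hmeas j) (by fun_prop)]
  simp only [mul_assoc]

end IsIsonormal

/-- Convergence in law is pointwise convergence of the characteristic functions. -/
lemma tendstoInDistribution_iff_charFun [IsProbabilityMeasure P] {X : ℕ → Ω → ℝ} {Z : Ω → ℝ}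
    (hX : ∀ n, AEMeasurable (X n) P) (hZ : AEMeasurable Z P) :
    TendstoInDistribution X atTop Z (fun _ => P) P ↔
      ∀ t, Tendsto (fun n => charFun (P.map (X n)) t) atTop (𝓝 (charFun (P.map Z) t)) :=
  ⟨fun h => ProbabilityMeasure.tendsto_iff_tendsto_charFun.1 h.tendsto,
    fun h => ⟨hX, hZ, ProbabilityMeasure.tendsto_iff_tendsto_charFun.2 h⟩⟩

end Law

end Wiener

namespace Wiener

/-! ### Gaussian integration by parts for functions of temperate growth. -/

section IntegrationByParts

lemma hasDerivAt_gaussianPDFReal (x : ℝ) :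
    HasDerivAt (gaussianPDFReal 0 1) (-x * gaussianPDFReal 0 1 x) x := by
  have h1 : HasDerivAt (fun x : ℝ => -(x - 0) ^ 2 / (2 * ((1 : NNReal) : ℝ))) (-x) x := by
    have := (((hasDerivAt_id x).sub_const 0).pow 2).neg.div_const (2 * ((1 : NNReal) : ℝ))
    refine this.congr_deriv ?_
    simp
    ring
  have h2 := h1.exp.const_mul (√(2 * Real.pi * ((1 : NNReal) : ℝ)))⁻¹
  refine h2.congr_deriv ?_
  rw [gaussianPDFReal]
  ring

lemma integrable_gaussianReal_iff {u : ℝ → ℝ} :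
    Integrable u (gaussianReal 0 1) ↔ Integrable (fun x => gaussianPDFReal 0 1 x * u x) := by
  rw [gaussianReal_of_var_ne_zero _ one_ne_zero, integrable_withDensity_iff_integrable_smul'
    (measurable_gaussianPDF 0 1) (ae_of_all _ fun _ => gaussianPDF_lt_top)]
  simp [toReal_gaussianPDF]

/-- Stein's identity for the standard normal distribution. -/
lemma integral_deriv_gaussianReal {u u' : ℝ → ℝ} (hu : ∀ x, HasDerivAt u (u' x) x)
    (iu : Integrable u (gaussianReal 0 1)) (iu' : Integrable u' (gaussianReal 0 1))
    (ixu : Integrable (fun x => u x * x) (gaussianReal 0 1)) :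
    ∫ x, u' x ∂(gaussianReal 0 1) = ∫ x, u x * x ∂(gaussianReal 0 1) := by
  rw [integrable_gaussianReal_iff] at iu iu' ixu
  -- Integration by parts against the density, whose derivative is -x times itself; integrability of
  -- the three products removes the boundary terms.
  have := integral_mul_deriv_eq_deriv_mul_of_integrable (u := gaussianPDFReal 0 1) (v := u)
    (fun x _ => hasDerivAt_gaussianPDFReal x) (fun x _ => hu x) iu'
    (ixu.neg.congr (ae_of_all _ fun x => by simp; ring)) iu
  rw [integral_gaussianReal_eq_integral_smul one_ne_zero,
    integral_gaussianReal_eq_integral_smul one_ne_zero]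
  simp only [smul_eq_mul]
  rw [this, ← integral_neg]
  refine integral_congr_ae (ae_of_all _ fun x => ?_)
  simp only
  ring

lemma _root_.Function.HasTemperateGrowth.fderiv {E F : Type*} [NormedAddCommGroup E]
    [NormedSpace ℝ E] [NormedAddCommGroup F] [NormedSpace ℝ F] {g : E → F}
    (hg : g.HasTemperateGrowth) : (_root_.fderiv ℝ g).HasTemperateGrowth := by
  refine ⟨hg.1.fderiv_right (by simp), fun n => ?_⟩
  obtain ⟨k, C, h⟩ := hg.2 (n + 1)
  exact ⟨k, C, fun x => by rw [norm_iteratedFDeriv_fderiv]; exact h x⟩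

lemma _root_.Function.HasTemperateGrowth.fderiv_apply {E F : Type*} [NormedAddCommGroup E]
    [NormedSpace ℝ E] [NormedAddCommGroup F] [NormedSpace ℝ F] {g : E → F}
    (hg : g.HasTemperateGrowth) (a : E) :
    (fun x => _root_.fderiv ℝ g x a).HasTemperateGrowth :=
  (ContinuousLinearMap.apply ℝ F a).hasTemperateGrowth.comp hg.fderiv

variable {Ω : Type*} [MeasurableSpace Ω] {P : Measure Ω}
  {H : Type*} [NormedAddCommGroup H] [InnerProductSpace ℝ H] {W : H → Ω → ℝ}

/-- A function of temperate growth of a random vector with all moments has all moments. -/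
lemma _root_.Function.HasTemperateGrowth.memLp_comp [IsFiniteMeasure P] {E F : Type*}
    [NormedAddCommGroup E]
    [NormedSpace ℝ E] [NormedAddCommGroup F] [NormedSpace ℝ F] {g : E → F}
    (hg : g.HasTemperateGrowth) {X : Ω → E} (hX : ∀ p : ℝ≥0∞, p ≠ ∞ → MemLp X p P)
    {p : ℝ≥0∞} (hp : p ≠ ∞) : MemLp (fun ω => g (X ω)) p P := by
  obtain ⟨k, C, hC⟩ := hg.2 0
  have hmeas : AEStronglyMeasurable (fun ω => g (X ω)) P :=
    hg.1.continuous.comp_aestronglyMeasurable (hX 0 (by simp)).aestronglyMeasurable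
  have hmeas1 : AEStronglyMeasurable (fun ω => (1 + ‖X ω‖) ^ k) P := by
    have := (hX 0 (by simp)).aestronglyMeasurable
    exact ((continuous_const.add continuous_norm).pow k).comp_aestronglyMeasurable this
  have hpow : MemLp (fun ω => (1 + ‖X ω‖) ^ k) p P := by
    rcases Nat.eq_zero_or_pos k with rfl | hk
    · simpa using memLp_const (1 : ℝ)
    · have h1 : MemLp (fun ω => 1 + ‖X ω‖) (p * k) P :=
        (memLp_const (1 : ℝ)).add (hX (p * k) (ENNReal.mul_ne_top hp (by simp))).norm
      have h2 := h1.norm_rpow_div (k : ℝ≥0∞)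
      rw [ENNReal.mul_div_cancel_right (by exact_mod_cast hk.ne') (by simp)] at h2
      refine h2.congr_norm hmeas1
        (ae_of_all _ fun ω => ?_)
      simp
  refine (hpow.const_mul C).of_le hmeas (ae_of_all _ fun ω => ?_)
  have h3 := hC (X ω)
  rw [norm_iteratedFDeriv_zero] at h3
  exact h3.trans (le_abs_self _)

namespace IsIsonormal

lemma hasGaussianLaw_pi (hW : IsIsonormal W P) {κ : Type*} [Fintype κ] (φ : κ → H) :
    HasGaussianLaw (fun ω i => W (φ i) ω) P := by
  have hG : IsGaussianProcess (W ∘ φ) P := hW.isGaussianProcess.comp_right φ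
  have h1 := hG.hasGaussianLaw Finset.univ
  let L : ({i // i ∈ (Finset.univ : Finset κ)} → ℝ) →L[ℝ] (κ → ℝ) :=
    ContinuousLinearMap.pi fun i => ContinuousLinearMap.proj ⟨i, Finset.mem_univ i⟩
  exact h1.map L

lemma memLp_pi (hW : IsIsonormal W P) {κ : Type*} [Fintype κ] (φ : κ → H) {p : ℝ≥0∞}
    (hp : p ≠ ∞) : MemLp (fun ω i => W (φ i) ω) p P :=
  (hW.hasGaussianLaw_pi φ).memLp hp

lemma memLp_comp (hW : IsIsonormal W P) {κ : Type*} [Fintype κ] (φ : κ → H) {F : Type*}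
    [NormedAddCommGroup F] [NormedSpace ℝ F] {g : (κ → ℝ) → F} (hg : g.HasTemperateGrowth)
    {p : ℝ≥0∞} (hp : p ≠ ∞) : MemLp (fun ω => g (fun i => W (φ i) ω)) p P := by
  have := hW.isGaussianProcess.isProbabilityMeasure
  exact hg.memLp_comp (fun _ hq => hW.memLp_pi φ hq) hp

lemma indepFun_of_inner_eq_zero (hW : IsIsonormal W P) {κ : Type*} (φ : κ → H)
    {h : H} (hφ : ∀ i, inner ℝ (φ i) h = 0) :
    IndepFun (fun ω i => W (φ i) ω) (W h) P := by
  have hG : IsGaussianProcess (Sum.elim (fun i => W (φ i)) (fun _ : Unit => W h)) P := by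
    convert! hW.isGaussianProcess.comp_right (Sum.elim φ fun _ : Unit => h) using 1
    funext i
    cases i <;> rfl
  have := hG.indepFun_of_covariance_eq_zero (fun _ => hW.isGaussianProcess.aemeasurable _)
    (fun _ => hW.isGaussianProcess.aemeasurable _)
    (fun s _ => by rw [hW.covariance_eq_inner, hφ])
  exact this.comp measurable_id (measurable_pi_apply ())

/-- Gaussian integration by parts, for a unit vector. -/
lemma integral_fderiv_of_norm_eq_one (hW : IsIsonormal W P) {κ : Type*} [Fintype κ] (φ : κ → H)
    {g : (κ → ℝ) → ℝ} (hg : g.HasTemperateGrowth) {h : H} (hh : ‖h‖ = 1) :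
    ∫ ω, fderiv ℝ g (fun i => W (φ i) ω) (fun i => inner ℝ (φ i) h) ∂P =
      ∫ ω, g (fun i => W (φ i) ω) * W h ω ∂P := by
  have := hW.isGaussianProcess.isProbabilityMeasure
  -- Split each φ_i into its component along h and the orthogonal rest. `Y` collects the rests and
  -- is independent of `W h`, so for fixed `Y` the claim is Stein's identity in the single variable
  -- `W h`.
  set a : κ → ℝ := fun i => inner ℝ (φ i) h with ha
  set Y : Ω → κ → ℝ := fun ω i => W (φ i - a i • h) ω with hY
  have hYm : AEMeasurable Y P := (hW.hasGaussianLaw_pi fun i => φ i - a i • h).aemeasurable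
  have hZm : AEMeasurable (W h) P := hW.isGaussianProcess.aemeasurable h
  have hX : ∀ᵐ ω ∂P, (fun i => W (φ i) ω) = Y ω + W h ω • a := by
    have : ∀ i, ∀ᵐ ω ∂P, W (φ i) ω = Y ω i + W h ω * a i := fun i => by
      filter_upwards [hW.ae_lin 1 (a i) (φ i - a i • h) h] with ω h1
      simp only [one_smul, sub_add_cancel, one_mul] at h1
      rw [h1]
      ring
    filter_upwards [ae_all_iff.2 this] with ω h1
    funext i
    simpa using h1 i
  have hind : P.map (fun ω => (Y ω, W h ω)) = (P.map Y).prod (gaussianReal 0 1) := by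
    rw [← hW.map_eq_gaussianReal hh]
    refine (indepFun_iff_map_prod_eq_prod_map_map hYm hZm).1
      (hW.indepFun_of_inner_eq_zero _ fun i => ?_)
    rw [inner_sub_left, real_inner_smul_left, real_inner_self_eq_norm_sq, hh]
    simp [ha]
  have : IsProbabilityMeasure (P.map Y) := Measure.isProbabilityMeasure_map hYm
  have hdiff : Differentiable ℝ g := hg.1.differentiable (by simp)
  have hgc : Continuous g := hg.1.continuous
  have hg'c : Continuous fun x => fderiv ℝ g x a :=
    (hg.1.continuous_fderiv (by simp)).clm_apply continuous_const
  have hg' : (fun x => fderiv ℝ g x a).HasTemperateGrowth := hg.fderiv_apply a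
  have key : ∀ u : (κ → ℝ) × ℝ → ℝ, Continuous u →
      Integrable (fun ω => u (Y ω, W h ω)) P → Integrable u ((P.map Y).prod (gaussianReal 0 1)) ∧
      ∫ ω, u (Y ω, W h ω) ∂P = ∫ y, ∫ z, u (y, z) ∂(gaussianReal 0 1) ∂(P.map Y) := by
    intro u hu hi
    have h1 : Integrable u ((P.map Y).prod (gaussianReal 0 1)) := by
      rw [← hind, integrable_map_measure hu.aestronglyMeasurable (hYm.prodMk hZm)]
      exact hi
    refine ⟨h1, ?_⟩
    rw [← integral_prod _ h1, ← hind, integral_map (hYm.prodMk hZm) hu.aestronglyMeasurable]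
  have hcW := hW.memLp h (p := 2) (by norm_num)
  obtain ⟨i1, -⟩ := key (fun q => g (q.1 + q.2 • a)) (by fun_prop)
    (((hW.memLp_comp φ hg (p := 1) (by simp)).integrable le_rfl).congr (by
      filter_upwards [hX] with ω h1
      rw [h1]))
  obtain ⟨i2, e2⟩ := key (fun q => fderiv ℝ g (q.1 + q.2 • a) a)
    (hg'c.comp (by fun_prop : Continuous fun q : (κ → ℝ) × ℝ => q.1 + q.2 • a))
    (((hW.memLp_comp φ hg' (p := 1) (by simp)).integrable le_rfl).congr (by
      filter_upwards [hX] with ω h1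
      rw [h1]))
  obtain ⟨i3, e3⟩ := key (fun q => g (q.1 + q.2 • a) * q.2) (by fun_prop)
    (((hW.memLp_comp φ hg (p := 2) (by simp)).integrable_mul hcW).congr (by
      filter_upwards [hX] with ω h1
      simp [h1]))
  rw [integral_congr_ae (g := fun ω => fderiv ℝ g (Y ω + W h ω • a) a)
    (by filter_upwards [hX] with ω h1; rw [h1]), e2,
    integral_congr_ae (f := fun ω => g (fun i => W (φ i) ω) * W h ω)
      (g := fun ω => g (Y ω + W h ω • a) * W h ω)
    (by filter_upwards [hX] with ω h1; rw [h1]), e3]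
  refine integral_congr_ae ?_
  filter_upwards [i1.prod_right_ae, i2.prod_right_ae, i3.prod_right_ae] with y j1 j2 j3
  refine integral_deriv_gaussianReal (u := fun z => g (y + z • a)) (fun z => ?_) j1 j2 j3
  have h1 : HasDerivAt (fun z : ℝ => y + z • a) a z := by
    simpa using ((hasDerivAt_id z).smul_const a).const_add y
  exact (hdiff _).hasFDerivAt.comp_hasDerivAt z h1

/-- Gaussian integration by parts. -/
lemma integral_fderiv (hW : IsIsonormal W P) {κ : Type*} [Fintype κ] (φ : κ → H)
    {g : (κ → ℝ) → ℝ} (hg : g.HasTemperateGrowth) (h : H) :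
    ∫ ω, fderiv ℝ g (fun i => W (φ i) ω) (fun i => inner ℝ (φ i) h) ∂P =
      ∫ ω, g (fun i => W (φ i) ω) * W h ω ∂P := by
  rcases eq_or_ne h 0 with rfl | h0
  · have : ∀ᵐ ω ∂P, W 0 ω = 0 := by
      filter_upwards [hW.ae_lin 0 0 0 0] with ω h1
      simpa using h1
    rw [integral_congr_ae (f := fun ω => g (fun i => W (φ i) ω) * W 0 ω) (g := fun _ => 0)
      (by filter_upwards [this] with ω h1; rw [h1, mul_zero])]
    have e : (fun i => inner ℝ (φ i) (0 : H)) = (0 : κ → ℝ) := by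
      funext i
      simp
    rw [e]
    simp only [map_zero, integral_zero]
  · have h1 := hW.integral_fderiv_of_norm_eq_one φ hg (norm_smul_inv_norm (𝕜 := ℝ) h0)
    have h2 : ∀ᵐ ω ∂P, W h ω = ‖h‖ * W ((‖h‖⁻¹ : ℝ) • h) ω := by
      filter_upwards [hW.ae_lin ‖h‖ 0 ((‖h‖⁻¹ : ℝ) • h) 0] with ω h3
      simpa [smul_smul, mul_inv_cancel₀ (norm_ne_zero_iff.2 h0)] using h3
    have e : (fun i => inner ℝ (φ i) h) = ‖h‖ • fun i => inner ℝ (φ i) ((‖h‖⁻¹ : ℝ) • h) := by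
      funext i
      simp [real_inner_smul_right, mul_inv_cancel_left₀ (norm_ne_zero_iff.2 h0)]
    rw [integral_congr_ae (f := fun ω => g (fun i => W (φ i) ω) * W h ω)
      (g := fun ω => ‖h‖ * (g (fun i => W (φ i) ω) * W ((‖h‖⁻¹ : ℝ) • h) ω))
      (by filter_upwards [h2] with ω h3; rw [h3]; ring), integral_const_mul, e]
    simp only [map_smul, smul_eq_mul]
    rw [integral_const_mul]
    congr 1

end IsIsonormal

end IntegrationByParts

end Wiener

namespace Wiener

namespace IsIsonormal

/-! ### Closability of the Malliavin derivative and its values on the second chaos. -/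

section Malliavin

variable {Ω : Type*} [MeasurableSpace Ω] {P : Measure Ω}
  {H : Type*} [NormedAddCommGroup H] [InnerProductSpace ℝ H] {W : H → Ω → ℝ}

lemma memLp_smul_const (hW : IsIsonormal W P) {κ : Type*} [Fintype κ] (φ : κ → H)
    {g : (κ → ℝ) → ℝ} (hg : g.HasTemperateGrowth) (h : H) :
    MemLp (fun ω => g (fun i => W (φ i) ω) • h) 2 P :=
  (ContinuousLinearMap.toSpanSingleton ℝ h).comp_memLp' (hW.memLp_comp φ hg (by norm_num))

/-- The variable here is the divergence of G h, for G = g(W(φ_i)): G W(h) minus the derivative of G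
in the direction h. -/
lemma memLp_divergence (hW : IsIsonormal W P) {κ : Type*} [Fintype κ] (φ : κ → H)
    {g : (κ → ℝ) → ℝ} (hg : g.HasTemperateGrowth) (h : H) :
    MemLp (fun ω => g (fun i => W (φ i) ω) * W h ω -
      fderiv ℝ g (fun i => W (φ i) ω) (fun i => inner ℝ (φ i) h)) 2 P := by
  have : ENNReal.HolderTriple 4 4 2 := ⟨by
    rw [← ENNReal.toReal_eq_toReal_iff' (by finiteness) (by finiteness)]
    rw [ENNReal.toReal_add (by finiteness) (by finiteness)]
    norm_num [ENNReal.toReal_inv]⟩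
  exact ((hW.memLp h (p := 4) (by norm_num)).mul (hW.memLp_comp φ hg (p := 4) (by norm_num))).sub
    (hW.memLp_comp φ (hg.fderiv_apply _) (by norm_num))

/-- The duality between the Malliavin derivative and the divergence of `G h`, for smooth cylindrical
random variables `G`. -/
lemma inner_smul_const_of_mem_closure (hW : IsIsonormal W P) {p : Lp ℝ 2 P × Lp H 2 P}
    (hp : p ∈ closure (cylinderGraph W P)) {m : ℕ} (ψ : Fin m → H) {g : (Fin m → ℝ) → ℝ}
    (hg : g.HasTemperateGrowth) (h : H) :
    inner ℝ p.2 ((hW.memLp_smul_const ψ hg h).toLp _) =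
      inner ℝ p.1 ((hW.memLp_divergence ψ hg h).toLp _) := by
  refine closure_minimal (s := cylinderGraph W P)
    (t := {p | inner ℝ p.2 ((hW.memLp_smul_const ψ hg h).toLp _) =
      inner ℝ p.1 ((hW.memLp_divergence ψ hg h).toLp _)}) ?_
    (isClosed_eq (by fun_prop) (by fun_prop)) hp
  rintro ⟨F, U⟩ ⟨n, φ, u, hu, hF, hU⟩
  simp only [Set.mem_ofPred_eq] at hF hU ⊢
  rw [L2.inner_def, L2.inner_def]
  -- Concatenation makes the product of the two cylindrical variables a function of one Gaussian
  -- vector; integration by parts applied to it, with the Leibniz rule, is the duality.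
  let φψ : Fin n ⊕ Fin m → H := Sum.elim φ ψ
  let L₁ : (Fin n ⊕ Fin m → ℝ) →L[ℝ] (Fin n → ℝ) :=
    ContinuousLinearMap.pi fun i => ContinuousLinearMap.proj (Sum.inl i)
  let L₂ : (Fin n ⊕ Fin m → ℝ) →L[ℝ] (Fin m → ℝ) :=
    ContinuousLinearMap.pi fun i => ContinuousLinearMap.proj (Sum.inr i)
  have hu₁ : (fun x => u (L₁ x)).HasTemperateGrowth := hu.comp L₁.hasTemperateGrowth
  have hg₁ : (fun x => g (L₂ x)).HasTemperateGrowth := hg.comp L₂.hasTemperateGrowth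
  have key := hW.integral_fderiv φψ (g := fun x => u (L₁ x) * g (L₂ x)) (hu₁.mul hg₁) h
  have hfd : ∀ x a, fderiv ℝ (fun x => u (L₁ x) * g (L₂ x)) x a =
      u (L₁ x) * fderiv ℝ g (L₂ x) (L₂ a) + fderiv ℝ u (L₁ x) (L₁ a) * g (L₂ x) := by
    intro x a
    have d1 := ((hu.1.differentiable (by simp)) (L₁ x)).hasFDerivAt.comp x L₁.hasFDerivAt
    have d2 := ((hg.1.differentiable (by simp)) (L₂ x)).hasFDerivAt.comp x L₂.hasFDerivAt
    rw [show (fun x => u (L₁ x) * g (L₂ x)) = (u ∘ L₁) * (g ∘ L₂) from rfl, (d1.mul d2).fderiv]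
    simp [mul_comm]
  simp only [hfd] at key
  have eX : ∀ ω, L₁ (fun i => W (φψ i) ω) = fun i => W (φ i) ω := fun ω => rfl
  have eY : ∀ ω, L₂ (fun i => W (φψ i) ω) = fun i => W (ψ i) ω := fun ω => rfl
  have eA : L₁ (fun i => inner ℝ (φψ i) h) = fun i => inner ℝ (φ i) h := rfl
  have eB : L₂ (fun i => inner ℝ (φψ i) h) = fun i => inner ℝ (ψ i) h := rfl
  simp only [eX, eY, eA, eB] at key
  have i1 : Integrable (fun ω => u (fun i => W (φ i) ω) *
      fderiv ℝ g (fun i => W (ψ i) ω) (fun i => inner ℝ (ψ i) h)) P :=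
    (hW.memLp_comp φ hu (p := 2) (by norm_num)).integrable_mul
      (hW.memLp_comp ψ (hg.fderiv_apply _) (p := 2) (by norm_num))
  have i2 : Integrable (fun ω => fderiv ℝ u (fun i => W (φ i) ω) (fun i => inner ℝ (φ i) h) *
      g (fun i => W (ψ i) ω)) P :=
    (hW.memLp_comp φ (hu.fderiv_apply _) (p := 2) (by norm_num)).integrable_mul
      (hW.memLp_comp ψ hg (p := 2) (by norm_num))
  have i3 : Integrable (fun ω => u (fun i => W (φ i) ω) * g (fun i => W (ψ i) ω) * W h ω) P :=
    (hW.memLp_comp φψ (hu₁.mul hg₁) (p := 2) (by norm_num)).integrable_mul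
      (hW.memLp h (p := 2) (by norm_num))
  rw [integral_add i1 i2] at key
  have hexp : ∀ ω, fderiv ℝ u (fun i => W (φ i) ω) (fun i => inner ℝ (φ i) h) =
      ∑ i, fderiv ℝ u (fun j => W (φ j) ω) (Pi.single i 1) * inner ℝ (φ i) h := by
    intro ω
    conv_lhs => rw [pi_eq_sum_univ' fun i => inner ℝ (φ i) h, map_sum]
    simp [mul_comm]
  calc _ = ∫ ω, fderiv ℝ u (fun i => W (φ i) ω) (fun i => inner ℝ (φ i) h) *
        g (fun i => W (ψ i) ω) ∂P := by
        refine integral_congr_ae ?_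
        filter_upwards [hU, (hW.memLp_smul_const ψ hg h).coeFn_toLp] with ω h1 h2
        rw [h1, h2, hexp, sum_inner, Finset.sum_mul]
        refine Finset.sum_congr rfl fun i _ => ?_
        rw [real_inner_smul_left, real_inner_smul_right]
        ring
    _ = ∫ ω, (u (fun i => W (φ i) ω) * g (fun i => W (ψ i) ω) * W h ω -
          u (fun i => W (φ i) ω) *
            fderiv ℝ g (fun i => W (ψ i) ω) (fun i => inner ℝ (ψ i) h)) ∂P := by
        rw [integral_sub i3 i1, ← key, add_sub_cancel_left]
    _ = _ := by
        refine integral_congr_ae ?_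
        filter_upwards [hF, (hW.memLp_divergence ψ hg h).coeFn_toLp] with ω h1 h2
        rw [h1, h2, RCLike.inner_apply, conj_trivial]
        ring

/-- The Malliavin derivative is closable. -/
lemma eq_of_mem_closure (hW : IsIsonormal W P) {F : Lp ℝ 2 P} {U U' : Lp H 2 P}
    (hU : (F, U) ∈ closure (cylinderGraph W P)) (hU' : (F, U') ∈ closure (cylinderGraph W P)) :
    U = U' := by
  -- By duality, pairings with the fields G φ depend on F alone, so U - U' is orthogonal to every
  -- cylindrical derivative. U and U' are limits of such derivatives, so U - U' is orthogonal to
  -- itself, and no density of cylindrical fields is needed.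
  have key : ∀ q ∈ closure (cylinderGraph W P), inner ℝ (U - U') q.2 = 0 := by
    intro q hq
    refine closure_minimal (s := cylinderGraph W P) (t := {q | inner ℝ (U - U') q.2 = 0}) ?_
      (isClosed_eq (by fun_prop) continuous_const) hq
    rintro ⟨G, V⟩ ⟨n, φ, u, hu, -, hV⟩
    have hVe : V = ∑ i, (hW.memLp_smul_const φ (hu.fderiv_apply (Pi.single i 1)) (φ i)).toLp _ := by
      refine Lp.ext ?_
      have h1 := ae_all_iff.2 fun i =>
        (hW.memLp_smul_const φ (hu.fderiv_apply (Pi.single i 1)) (φ i)).coeFn_toLp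
      filter_upwards [hV, Lp.coeFn_finsetSum Finset.univ fun i =>
        (hW.memLp_smul_const φ (hu.fderiv_apply (Pi.single i 1)) (φ i)).toLp _, h1] with ω h2 h3 h4
      rw [h2, h3, Finset.sum_apply]
      exact Finset.sum_congr rfl fun i _ => (h4 i).symm
    simp only [Set.mem_ofPred_eq, hVe, inner_sum]
    refine Finset.sum_eq_zero fun i _ => ?_
    rw [inner_sub_left, hW.inner_smul_const_of_mem_closure hU φ (hu.fderiv_apply (Pi.single i 1)),
      hW.inner_smul_const_of_mem_closure hU' φ (hu.fderiv_apply (Pi.single i 1)), sub_self]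
  have h1 : inner ℝ (U - U') (U - U') = 0 := by
    rw [inner_sub_right (U - U'), key _ hU, key _ hU', sub_self]
  exact sub_eq_zero.1 (inner_self_eq_zero.1 h1)

lemma malliavinD_eq (hW : IsIsonormal W P) {F : Lp ℝ 2 P} {U : Lp H 2 P}
    (hU : (F, U) ∈ closure (cylinderGraph W P)) : malliavinD W P F = U := by
  have h : ∃ U : Lp H 2 P, (F, U) ∈ closure (cylinderGraph W P) := ⟨U, hU⟩
  rw [malliavinD, dif_pos h]
  exact hW.eq_of_mem_closure h.choose_spec hU

/-- The random vector `W(a) a`. -/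
noncomputable def selfSmul (hW : IsIsonormal W P) (a : H) : Lp H 2 P :=
  MemLp.toLp (fun ω => W a ω • a) ((ContinuousLinearMap.toSpanSingleton ℝ a).comp_memLp'
    (hW.memLp a (p := 2) (by norm_num)))

lemma coeFn_selfSmul (hW : IsIsonormal W P) (a : H) :
    hW.selfSmul a =ᵐ[P] fun ω => W a ω • a := MemLp.coeFn_toLp _

lemma orthonormal_selfSmul (hW : IsIsonormal W P) {J : Type*} {v : J → H}
    (hv : Orthonormal ℝ v) : Orthonormal ℝ fun j => hW.selfSmul (v j) := by
  classical
  rw [orthonormal_iff_ite]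
  intro i j
  rw [L2.inner_def, integral_congr_ae
    (g := fun ω => inner ℝ (v i) (v j) * (W (v i) ω * W (v j) ω)), integral_const_mul,
    hW.integral_mul, orthonormal_iff_ite.1 hv]
  · split_ifs <;> simp
  · filter_upwards [hW.coeFn_selfSmul (v i), hW.coeFn_selfSmul (v j)] with ω h1 h2
    rw [h1, h2, real_inner_smul_left, real_inner_smul_right]
    ring

/-- The vectors W(v_j) v_j are orthonormal in L²(Ω; H), so square-summable coefficients suffice. -/
lemma exists_hasSum_selfSmul [CompleteSpace H] (hW : IsIsonormal W P) {J : Type*} {v : J → H}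
    (hv : Orthonormal ℝ v) {l : J → ℝ} (hl : Summable fun j => l j ^ 2) :
    ∃ U : Lp H 2 P, HasSum (fun j => l j • hW.selfSmul (v j)) U := by
  have h1 := (hW.orthonormal_selfSmul hv).orthogonalFamily
  refine ⟨_, Summable.hasSum ?_⟩
  have h2 := (h1.summable_iff_norm_sq_summable l).2 (by simpa using hl)
  simpa using h2

/-- The Malliavin derivative of a diagonal element of the second chaos. -/
lemma malliavinD_I₂ (hW : IsIsonormal W P) {J : Type*} {v : J → H} {l : J → ℝ}
    {f : HTensor H} {U : Lp H 2 P} (hf : HasSum (fun j => l j • pureTensor (v j) (v j)) f)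
    (hU : HasSum (fun j => (2 * l j) • hW.selfSmul (v j)) U) :
    malliavinD W P (hW.I₂ f) = U := by
  refine hW.malliavinD_eq (mem_closure_of_tendsto
    (((hW.I₂.continuous.tendsto _).comp hf).prodMk_nhds hU) (Eventually.of_forall fun S => ?_))
  -- Each partial sum is a quadratic polynomial in finitely many W(v_j), enumerated by `Fin` as
  -- `cylinderGraph` demands.
  let e := S.equivFin.symm
  refine ⟨S.card, fun i => v (e i), fun x => ∑ i, l (e i) * (x i ^ 2 - inner ℝ (v (e i)) (v (e i))),
    ?_, ?_, ?_⟩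
  · refine Function.HasTemperateGrowth.sum fun i _ => ?_
    have := (ContinuousLinearMap.proj i : (Fin S.card → ℝ) →L[ℝ] ℝ).hasTemperateGrowth
    exact (Function.HasTemperateGrowth.const _).mul ((this.pow 2).sub (.const _))
  · have h1 := (S.eventually_all (l := ae P)).2 fun j _ => hW.I₂_pureTensor (v j) (v j)
    have h2 := (S.eventually_all (l := ae P)).2 fun j _ =>
      Lp.coeFn_smul (l j) (hW.I₂ (pureTensor (v j) (v j)))
    simp only [Function.comp_apply, map_sum, map_smul]
    filter_upwards [h1, h2, Lp.coeFn_finsetSum S fun j => l j • hW.I₂ (pureTensor (v j) (v j))]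
      with ω h3 h4 h5
    rw [h5, Finset.sum_apply, ← Finset.sum_coe_sort, ← e.sum_comp]
    refine Finset.sum_congr rfl fun i _ => ?_
    rw [h4 _ (e i).2, Pi.smul_apply, h3 _ (e i).2, smul_eq_mul]
    ring
  · have h1 := (S.eventually_all (l := ae P)).2 fun j _ => hW.coeFn_selfSmul (v j)
    have h2 := (S.eventually_all (l := ae P)).2 fun j _ =>
      Lp.coeFn_smul (2 * l j) (hW.selfSmul (v j))
    filter_upwards [h1, h2, Lp.coeFn_finsetSum S fun j => (2 * l j) • hW.selfSmul (v j)]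
      with ω h3 h4 h5
    simp only [h5, Finset.sum_apply]
    rw [← Finset.sum_coe_sort, ← e.sum_comp]
    refine Finset.sum_congr rfl fun i _ => ?_
    rw [h4 _ (e i).2, Pi.smul_apply, h3 _ (e i).2, smul_smul]
    congr 1
    have hd : HasFDerivAt (fun x : Fin S.card → ℝ =>
        ∑ i, l (e i) * (x i ^ 2 - inner ℝ (v (e i)) (v (e i))))
        (∑ i, (l (e i)) • ((2 * W (v (e i)) ω) • (ContinuousLinearMap.proj i :
          (Fin S.card → ℝ) →L[ℝ] ℝ))) (fun j => W (v (e j)) ω) := by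
      refine HasFDerivAt.fun_sum fun i _ => ?_
      refine HasFDerivAt.const_mul ?_ _
      have := ((ContinuousLinearMap.proj i : (Fin S.card → ℝ) →L[ℝ] ℝ).hasFDerivAt
        (x := fun j => W (v (e j)) ω)).pow 2
      simpa using this.sub_const (inner ℝ (v (e i)) (v (e i)))
    rw [hd.fderiv]
    simp [Pi.single_apply]
    ring

/-- The scalar product of derivatives of diagonal elements of the second chaos. -/
lemma inner_hasSum_selfSmul (hW : IsIsonormal W P) {J : Type*} {v : J → H} (hv : Orthonormal ℝ v)
    {l m : J → ℝ} {U V : Lp H 2 P} {f : HTensor H} {c : ℝ}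
    (hU : HasSum (fun j => l j • hW.selfSmul (v j)) U)
    (hV : HasSum (fun j => m j • hW.selfSmul (v j)) V)
    (hf : HasSum (fun j => (l j * m j) • pureTensor (v j) (v j)) f)
    (hc : HasSum (fun j => l j * m j) c) :
    (fun ω => inner ℝ (U ω) (V ω)) =ᵐ[P] fun ω => hW.I₂ f ω + c := by
  classical
  have := hW.isGaussianProcess.isProbabilityMeasure
  -- Orthonormality of the v_j isolates one term of the series for `V` in each coordinate.
  have hcoord : ∀ i, (fun ω => inner ℝ (v i) (V ω)) =ᵐ[P] fun ω => m i * W (v i) ω := by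
    intro i
    let T : Lp H 2 P →L[ℝ] Lp ℝ 2 P := (innerSL ℝ (v i)).compLpL 2 P
    have h1 : ∀ j, T (m j • hW.selfSmul (v j)) =
        if j = i then (T (m i • hW.selfSmul (v i))) else 0 := by
      intro j
      split_ifs with hj
      · rw [hj]
      · rw [map_smul]
        have : T (hW.selfSmul (v j)) = 0 := by
          refine Lp.ext ?_
          filter_upwards [ContinuousLinearMap.coeFn_compLpL (innerSL ℝ (v i)) (hW.selfSmul (v j)),
            hW.coeFn_selfSmul (v j), Lp.coeFn_zero ℝ 2 P] with ω h2 h3 h4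
          rw [h2, h3, h4, innerSL_apply_apply, real_inner_smul_right, hv.2 (Ne.symm hj), mul_zero]
          rfl
        rw [this, smul_zero]
    have h2 : T V = T (m i • hW.selfSmul (v i)) := by
      refine (hV.mapL T).unique ?_
      rw [show (fun j => T (m j • hW.selfSmul (v j))) = _ from funext h1]
      exact hasSum_ite_eq i _
    filter_upwards [ContinuousLinearMap.coeFn_compLpL (innerSL ℝ (v i)) V,
      ContinuousLinearMap.coeFn_compLpL (innerSL ℝ (v i)) (m i • hW.selfSmul (v i)),
      Lp.coeFn_smul (m i) (hW.selfSmul (v i)), hW.coeFn_selfSmul (v i)] with ω h3 h4 h5 h6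
    rw [← innerSL_apply_apply ℝ, ← h3]
    change T V ω = _
    rw [h2]
    change ((innerSL ℝ (v i)).compLpL 2 P (m i • hW.selfSmul (v i))) ω = _
    rw [h4, h5, Pi.smul_apply, h6, innerSL_apply_apply, real_inner_smul_right,
      real_inner_smul_right, real_inner_self_eq_norm_sq, hv.1 i]
    ring
  have iUV : Integrable (fun ω => inner ℝ (U ω) (V ω)) P := L2.integrable_inner U V
  have iI : Integrable (fun ω => hW.I₂ f ω + c) P :=
    ((Lp.memLp (hW.I₂ f)).integrable (by norm_num)).add (integrable_const c)
  -- The pointwise inner product is a priori only integrable. Integrating over a set A amounts to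
  -- pairing with the indicator of A times V, which is continuous on L²(Ω; H), so the series for U
  -- may be integrated termwise. The constant c comes from W² = (W² - 1) + 1.
  refine Integrable.ae_eq_of_forall_setIntegral_eq _ _ iUV iI fun A hA _ => ?_
  have hVA : MemLp (A.indicator V) 2 P := (Lp.memLp V).indicator hA
  have h1 : HasSum (fun i => ∫ ω in A, (l i * m i) * W (v i) ω ^ 2 ∂P)
      (∫ ω in A, inner ℝ (U ω) (V ω) ∂P) := by
    have h2 := hU.mapL (innerSL ℝ (hVA.toLp _))
    have e : ∀ F : Lp H 2 P, innerSL ℝ (hVA.toLp _) F = ∫ ω in A, inner ℝ (F ω) (V ω) ∂P := by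
      intro F
      rw [innerSL_apply_apply, L2.inner_def, ← integral_indicator hA]
      refine integral_congr_ae ?_
      filter_upwards [hVA.coeFn_toLp] with ω h3
      rw [h3]
      by_cases hω : ω ∈ A
      · simp [hω, real_inner_comm]
      · simp [hω]
    simp only [e] at h2
    refine h2.congr_fun fun i => ?_
    refine integral_congr_ae (ae_restrict_of_ae ?_)
    filter_upwards [hcoord i, Lp.coeFn_smul (l i) (hW.selfSmul (v i)), hW.coeFn_selfSmul (v i)]
      with ω h3 h4 h5
    rw [h4, Pi.smul_apply, h5, real_inner_smul_left, real_inner_smul_left, h3]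
    ring
  have h2 : HasSum (fun i => ∫ ω in A, (l i * m i) * W (v i) ω ^ 2 ∂P)
      (∫ ω in A, (hW.I₂ f ω + c) ∂P) := by
    have h3 := (hf.mapL hW.I₂).mapL
      (innerSL ℝ (indicatorConstLp 2 hA (measure_ne_top P A) (1 : ℝ)))
    simp only [innerSL_apply_apply, L2.inner_indicatorConstLp_one] at h3
    have h4 := h3.add (hc.mul_right (P.real A))
    have e1 : ∫ ω in A, (hW.I₂ f ω + c) ∂P = ∫ ω in A, hW.I₂ f ω ∂P + c * P.real A := by
      rw [integral_add ((Lp.memLp (hW.I₂ f)).integrable (by norm_num)).integrableOn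
        (integrable_const c)]
      simp [mul_comm]
    rw [e1]
    refine h4.congr_fun fun i => ?_
    have e2 : ∫ ω in A, hW.I₂ ((l i * m i) • pureTensor (v i) (v i)) ω ∂P =
        ∫ ω in A, ((l i * m i) * W (v i) ω ^ 2 - l i * m i) ∂P := by
      refine integral_congr_ae (ae_restrict_of_ae ?_)
      rw [map_smul]
      filter_upwards [hW.I₂_pureTensor (v i) (v i),
        Lp.coeFn_smul (l i * m i) (hW.I₂ (pureTensor (v i) (v i)))] with ω h5 h6
      rw [h6, Pi.smul_apply, h5, real_inner_self_eq_norm_sq, hv.1 i, smul_eq_mul]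
      ring
    rw [e2, integral_sub ((hW.memLp (v i) (p := 2) (by norm_num)).integrable_sq.integrableOn.const_mul
      _) (integrable_const _)]
    simp [mul_comm]
  exact h1.unique h2

end Malliavin

end IsIsonormal

end Wiener

namespace Wiener

/-! ### Hermite orthogonality, chaos projections and the variables Γ. -/

lemma hasTemperateGrowth_aeval (p : Polynomial ℤ) :
    (fun x : ℝ => Polynomial.aeval x p).HasTemperateGrowth := by
  induction p using Polynomial.induction_on' with
  | add p q hp hq =>
    simp only [map_add]
    exact hp.add hq
  | monomial n a =>
    simp only [Polynomial.aeval_monomial]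
    exact (Function.HasTemperateGrowth.const _).mul (Function.HasTemperateGrowth.id'.pow n)

/-- The constant random variable `1`. -/
noncomputable def oneL2 {Ω : Type*} [MeasurableSpace Ω] (P : Measure Ω) [IsFiniteMeasure P] :
    Lp ℝ 2 P := (memLp_const (1 : ℝ)).toLp fun _ => 1

lemma coeFn_oneL2 {Ω : Type*} [MeasurableSpace Ω] (P : Measure Ω) [IsFiniteMeasure P] :
    oneL2 P =ᵐ[P] fun _ => 1 := MemLp.coeFn_toLp _

namespace IsIsonormal

variable {Ω : Type*} [MeasurableSpace Ω] {P : Measure Ω}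
  {H : Type*} [NormedAddCommGroup H] [InnerProductSpace ℝ H] {W : H → Ω → ℝ}

/-- Integration by parts with H_{q+1} = x H_q - H_q'. For k = 0 the truncated exponent k - 1 is
harmless because of the factor k. -/
lemma integral_hermite_succ_mul_pow (hW : IsIsonormal W P) {h : H} (hh : ‖h‖ = 1) (a : H)
    (q k : ℕ) :
    ∫ ω, Polynomial.aeval (W h ω) (Polynomial.hermite (q + 1)) * W a ω ^ k ∂P =
      k * inner ℝ a h * ∫ ω, Polynomial.aeval (W h ω) (Polynomial.hermite q) * W a ω ^ (k - 1) ∂P := by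
  let φ : Bool → H := fun b => if b then h else a
  let p₁ : (Bool → ℝ) →L[ℝ] ℝ := ContinuousLinearMap.proj true
  let p₂ : (Bool → ℝ) →L[ℝ] ℝ := ContinuousLinearMap.proj false
  have temp : ∀ (p : Polynomial ℤ) (m : ℕ),
      (fun x => Polynomial.aeval (p₁ x) p * p₂ x ^ m).HasTemperateGrowth := fun p m =>
    ((hasTemperateGrowth_aeval p).comp p₁.hasTemperateGrowth).mul (p₂.hasTemperateGrowth.pow m)
  have int : ∀ (p : Polynomial ℤ) (m : ℕ),
      Integrable (fun ω => Polynomial.aeval (W h ω) p * W a ω ^ m) P := fun p m =>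
    memLp_one_iff_integrable.1 (hW.memLp_comp φ (temp p m) (p := 1) (by simp))
  have int' : ∀ (p : Polynomial ℤ) (m : ℕ),
      Integrable (fun ω => W h ω * Polynomial.aeval (W h ω) p * W a ω ^ m) P := fun p m =>
    (int (Polynomial.X * p) m).congr (ae_of_all _ fun ω => by
      simp only [map_mul, Polynomial.aeval_X])
  have key := hW.integral_fderiv φ (temp (Polynomial.hermite q) k) h
  have hfd : ∀ x b, fderiv ℝ (fun x => Polynomial.aeval (p₁ x) (Polynomial.hermite q) * p₂ x ^ k) x b
      = Polynomial.aeval (p₁ x) (Polynomial.derivative (Polynomial.hermite q)) * p₂ x ^ k * p₁ b +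
        k * p₂ b * (Polynomial.aeval (p₁ x) (Polynomial.hermite q) * p₂ x ^ (k - 1)) := by
    intro x b
    have d1 := ((Polynomial.hermite q).hasDerivAt_aeval (p₁ x)).comp_hasFDerivAt x p₁.hasFDerivAt
    have d2 := (p₂.hasFDerivAt (x := x)).pow k
    have d3 := (d1.mul d2).fderiv
    rw [show (fun x => Polynomial.aeval (p₁ x) (Polynomial.hermite q) * p₂ x ^ k) =
      ((fun x => Polynomial.aeval x (Polynomial.hermite q)) ∘ p₁) * (p₂ ^ k : (Bool → ℝ) → ℝ) from rfl]
    erw [d3]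
    simp
    ring
  have e1 : p₁ (fun i => inner ℝ (φ i) h) = 1 := by
    change inner ℝ h h = (1 : ℝ)
    rw [real_inner_self_eq_norm_sq, hh]
    norm_num
  have e2 : p₂ (fun i => inner ℝ (φ i) h) = inner ℝ a h := rfl
  simp only [hfd, e1, e2] at key
  have e3 : ∀ ω, p₁ (fun i => W (φ i) ω) = W h ω := fun _ => rfl
  have e4 : ∀ ω, p₂ (fun i => W (φ i) ω) = W a ω := fun _ => rfl
  simp only [e3, e4, mul_one] at key
  rw [integral_add (int _ _) ((int _ _).const_mul _), integral_const_mul] at key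
  rw [← eq_sub_iff_add_eq'] at key
  rw [key, ← integral_sub ((int' _ _).congr (ae_of_all _ fun ω => by simp only; ring)) (int _ _)]
  refine integral_congr_ae (ae_of_all _ fun ω => ?_)
  simp only [Polynomial.hermite_succ, map_sub, map_mul, Polynomial.aeval_X]
  ring

lemma integral_hermite_succ (hW : IsIsonormal W P) {h : H} (hh : ‖h‖ = 1) (q : ℕ) :
    ∫ ω, Polynomial.aeval (W h ω) (Polynomial.hermite (q + 1)) ∂P = 0 := by
  simpa using hW.integral_hermite_succ_mul_pow hh 0 q 0

/-- Each integration by parts lowers both the Hermite index and the power of W(a). For q = 1 a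
multiple of the mean of W(a) is left, for q > 2 a multiple of the mean of a Hermite polynomial of
positive degree; both vanish. -/
lemma integral_hermite_mul_sq (hW : IsIsonormal W P) {h : H} (hh : ‖h‖ = 1) (a : H) {q : ℕ}
    (hq0 : q ≠ 0) (hq : q ≠ 2) :
    ∫ ω, Polynomial.aeval (W h ω) (Polynomial.hermite q) * W a ω ^ 2 ∂P = 0 := by
  obtain ⟨m, rfl⟩ := Nat.exists_eq_succ_of_ne_zero hq0
  rw [Nat.succ_eq_add_one, hW.integral_hermite_succ_mul_pow hh]
  rcases m with _ | m
  · simp [hW.integral_eq_zero]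
  · rw [hW.integral_hermite_succ_mul_pow hh]
    obtain ⟨n, rfl⟩ := Nat.exists_eq_succ_of_ne_zero (fun h0 : m = 0 => hq (by simp [h0]))
    have h1 : ∫ ω, Polynomial.aeval (W h ω) (Polynomial.hermite (n + 1)) * W a ω ^ 0 ∂P = 0 := by
      simpa only [pow_zero, mul_one] using hW.integral_hermite_succ hh n
    simp only [Nat.succ_eq_add_one, Nat.add_one_sub_one, Nat.sub_self, h1, mul_zero]

lemma mem_orthogonal_chaos {H : Type*} [NormedAddCommGroup H] {W : H → Ω → ℝ} {q : ℕ} {X : Lp ℝ 2 P}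
    (h : ∀ F : Lp ℝ 2 P, ∀ g : H, ‖g‖ = 1 →
      F =ᵐ[P] (fun ω => Polynomial.aeval (W g ω) (Polynomial.hermite q)) → inner ℝ X F = 0) :
    X ∈ (chaos W P q)ᗮ := by
  rw [Submodule.mem_orthogonal']
  have : chaos W P q ≤ LinearMap.ker (innerSL ℝ X : Lp ℝ 2 P →L[ℝ] ℝ).toLinearMap := by
    refine Submodule.topologicalClosure_minimal _ (Submodule.span_le.2 ?_)
      (ContinuousLinearMap.isClosed_ker _)
    rintro F ⟨g, hg, hF⟩
    simpa using h F g hg hF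
  intro F hF
  simpa using this hF

lemma J_oneL2 (hW : IsIsonormal W P) [IsFiniteMeasure P] {q : ℕ} (hq : q ≠ 0) :
    J W P q (oneL2 P) = 0 := by
  rw [J, Submodule.starProjection_apply_eq_zero_iff]
  refine mem_orthogonal_chaos fun F g hg hF => ?_
  obtain ⟨m, rfl⟩ := Nat.exists_eq_succ_of_ne_zero hq
  rw [L2.inner_def, ← hW.integral_hermite_succ hg m]
  refine integral_congr_ae ?_
  filter_upwards [hF, coeFn_oneL2 P] with ω h1 h2
  rw [h1, h2]
  simp

lemma I₂_mem_chaos (hW : IsIsonormal W P) {f : HTensor H} (hf : f ∈ symTensor H) :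
    hW.I₂ f ∈ chaos W P 2 := by
  refine symTensor_le (K := (chaos W P 2).comap hW.I₂.toLinearMap) ?_ (fun a => ?_) hf
  · exact (Submodule.isClosed_topologicalClosure _).preimage hW.I₂.continuous
  · rcases eq_or_ne a 0 with rfl | ha
    · have : pureTensor (0 : H) 0 = 0 := by
        rw [← norm_eq_zero, norm_pureTensor]
        simp
      simp [this]
    · have e : pureTensor a a = ‖a‖ ^ 2 • pureTensor ((‖a‖⁻¹ : ℝ) • a) ((‖a‖⁻¹ : ℝ) • a) := by
        rw [pureTensor_smul_left, pureTensor_smul_right, smul_smul, smul_smul]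
        field_simp
        simp
      rw [e]
      refine Submodule.smul_mem _ _ (Submodule.le_topologicalClosure _ (Submodule.subset_span
        ⟨(‖a‖⁻¹ : ℝ) • a, norm_smul_inv_norm (𝕜 := ℝ) ha, ?_⟩))
      filter_upwards [hW.I₂_pureTensor ((‖a‖⁻¹ : ℝ) • a) ((‖a‖⁻¹ : ℝ) • a)] with ω h1
      have h2 : ‖(‖a‖⁻¹ : ℝ) • a‖ = 1 := norm_smul_inv_norm (𝕜 := ℝ) ha
      erw [h1]
      rw [real_inner_self_eq_norm_sq, h2]
      simp [Polynomial.hermite_succ]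

lemma J_I₂ (hW : IsIsonormal W P) {f : HTensor H} (hf : f ∈ symTensor H) {q : ℕ} (hq : q ≠ 0) :
    J W P q (hW.I₂ f) = if q = 2 then hW.I₂ f else 0 := by
  have := hW.isGaussianProcess.isProbabilityMeasure
  split_ifs with h2
  · subst h2
    exact Submodule.starProjection_eq_self_iff.2 (hW.I₂_mem_chaos hf)
  · rw [J, Submodule.starProjection_apply_eq_zero_iff]
    refine mem_orthogonal_chaos fun F g hg hF => ?_
    rw [real_inner_comm]
    have hf0 := symTensor_le
      (K := LinearMap.ker ((innerSL ℝ F).comp hW.I₂ : HTensor H →L[ℝ] ℝ).toLinearMap)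
      (ContinuousLinearMap.isClosed_ker _) (fun a => ?_) hf
    · simpa using hf0
    change inner ℝ F (hW.I₂ (pureTensor a a)) = 0
    obtain ⟨m, rfl⟩ := Nat.exists_eq_succ_of_ne_zero hq
    have e : inner ℝ F (hW.I₂ (pureTensor a a)) =
        ∫ ω, (Polynomial.aeval (W g ω) (Polynomial.hermite (m + 1)) * W a ω ^ 2 -
          Polynomial.aeval (W g ω) (Polynomial.hermite (m + 1)) * inner ℝ a a) ∂P := by
      rw [L2.inner_def]
      refine integral_congr_ae ?_
      filter_upwards [hF, hW.I₂_pureTensor a a] with ω h3 h4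
      rw [h3, h4, RCLike.inner_apply, conj_trivial]
      simp only [Nat.succ_eq_add_one]
      ring
    have hm : MemLp (fun ω => Polynomial.aeval (W g ω) (Polynomial.hermite (m + 1))) 2 P :=
      (hasTemperateGrowth_aeval _).memLp_comp (fun _ hp => hW.memLp g hp) (by norm_num)
    have hs : MemLp (fun ω => W a ω ^ 2) 2 P := by
      simpa only [pow_two] using hW.memLp_mul a a
    have i1 : Integrable (fun ω => Polynomial.aeval (W g ω) (Polynomial.hermite (m + 1)) *
        W a ω ^ 2) P := hm.integrable_mul hs
    rw [e, integral_sub i1 ((hm.integrable (by norm_num)).mul_const _),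
      hW.integral_hermite_mul_sq hg a hq h2, integral_mul_const, hW.integral_hermite_succ hg]
    simp

lemma Linv_I₂_add (hW : IsIsonormal W P) [IsFiniteMeasure P] {f : HTensor H}
    (hf : f ∈ symTensor H) (c : ℝ) :
    Linv W P (hW.I₂ f + c • oneL2 P) = -(1 / 2 : ℝ) • hW.I₂ f := by
  -- The summation index 1 is the chaos of order 2; constants lie in no chaos of positive order and
  -- drop out.
  rw [Linv, tsum_eq_single 1]
  · rw [map_add, map_smul, hW.J_I₂ hf (by norm_num), hW.J_oneL2 (by norm_num)]
    norm_num
  · intro q hq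
    rw [map_add, map_smul, hW.J_I₂ hf (by omega), hW.J_oneL2 (by omega), if_neg (by omega)]
    simp

lemma integral_I₂ (hW : IsIsonormal W P) (f : HTensor H) : ∫ ω, hW.I₂ f ω ∂P = 0 := by
  have := hW.isGaussianProcess.isProbabilityMeasure
  have e : ∀ f, ∫ ω, hW.I₂ f ω ∂P = inner ℝ (oneL2 P) (hW.I₂ f) := by
    intro f
    rw [L2.inner_def]
    refine integral_congr_ae ?_
    filter_upwards [coeFn_oneL2 P] with ω h1
    rw [h1]
    simp
  have h0 := mem_of_pureTensor_mem
    (LinearMap.ker ((innerSL ℝ (oneL2 P)).comp hW.I₂ : HTensor H →L[ℝ] ℝ).toLinearMap)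
    (ContinuousLinearMap.isClosed_ker _) (fun a b => ?_) f
  · rw [e]
    simpa using h0
  · change inner ℝ (oneL2 P) (hW.I₂ (pureTensor a b)) = 0
    rw [← e, integral_congr_ae (hW.I₂_pureTensor a b),
      integral_sub (hW.integrable_mul a b) (integrable_const _), hW.integral_mul]
    simp

/-- By `inner_wickMap` the inner product is that of the kernels plus that with one kernel swapped;
for symmetric kernels the two terms agree, whence the 2. -/
lemma norm_sq_I₂ (hW : IsIsonormal W P) {f : HTensor H} (hf : f ∈ symTensor H) :
    ‖hW.I₂ f‖ ^ 2 = 2 * ‖f‖ ^ 2 := by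
  have hcl : IsClosed {f : HTensor H | ‖hW.I₂ f‖ ^ 2 = 2 * ‖f‖ ^ 2} :=
    isClosed_eq (by fun_prop) (by fun_prop)
  refine closure_minimal ?_ hcl hf
  intro g hg
  obtain ⟨t, rfl, ht⟩ : ∃ t : H ⊗[ℝ] H, (t : HTensor H) = g ∧ TensorProduct.comm ℝ H H t = t := by
    refine Submodule.span_induction (p := fun g _ => ∃ t : H ⊗[ℝ] H, (t : HTensor H) = g ∧
      TensorProduct.comm ℝ H H t = t) ?_ ?_ ?_ ?_ hg
    · rintro _ ⟨h, rfl⟩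
      exact ⟨h ⊗ₜ h, rfl, by simp⟩
    · exact ⟨0, UniformSpace.Completion.coe_zero, by simp⟩
    · rintro _ _ _ _ ⟨x, rfl, hx⟩ ⟨y, rfl, hy⟩
      exact ⟨x + y, UniformSpace.Completion.coe_add _ _, by simp [hx, hy]⟩
    · rintro r _ _ ⟨x, rfl, hx⟩
      exact ⟨r • x, UniformSpace.Completion.coe_smul _ _, by simp [hx]⟩
  simp only [Set.mem_ofPred_eq]
  rw [I₂_coe, ← real_inner_self_eq_norm_sq, inner_wickMap, ht, UniformSpace.Completion.norm_coe,
    show inner ℝ t t = ‖t‖ ^ 2 from real_inner_self_eq_norm_sq t]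
  ring

lemma toL2_eq {X : Ω → ℝ} {F : Lp ℝ 2 P} (h : X =ᵐ[P] F) : toL2 P X = F := by
  have hX : MemLp X 2 P := (Lp.memLp F).ae_eq h.symm
  rw [toL2, dif_pos hX]
  exact Lp.ext (hX.coeFn_toLp.trans h)

/-- The variables `Γ` of an element of the second chaos are, up to constants, double integrals of
iterated contractions. -/
theorem exists_Gam_eq [CompleteSpace H] (hW : IsIsonormal W P) [IsFiniteMeasure P] {ι : Type*}
    (e : HilbertBasis ι ℝ H) {f : HTensor H} (hf : f ∈ symTensor H) (r : ℕ) :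
    ∃ c : ℝ, Gam W P (hW.I₂ f) r =
      hW.I₂ ((2 : ℝ) ^ r • iterContraction e f (r + 1)) + c • oneL2 P := by
  obtain ⟨J, v, l, hl⟩ := exists_hasSum_diag hf
  have hsq := hasSum_sq_of_hasSum_diag hl
  induction r with
  | zero => exact ⟨0, by simp [Gam, iterContraction]⟩
  | succ r ih =>
    obtain ⟨c, hc⟩ := ih
    have hr := hasSum_diag_iterContraction e hl r
    have hr1 := hasSum_diag_iterContraction e hl (r + 1)
    have hr' : HasSum (fun j => ((2 : ℝ) ^ r * l j ^ (r + 1)) • pureTensor (v j) (v j))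
        ((2 : ℝ) ^ r • iterContraction e f (r + 1)) := by
      simpa only [smul_smul] using hr.const_smul ((2 : ℝ) ^ r)
    have hr2 : HasSum (fun j => (-(1 / 2) * ((2 : ℝ) ^ r * l j ^ (r + 1))) • pureTensor (v j) (v j))
        ((-(1 / 2) : ℝ) • (2 : ℝ) ^ r • iterContraction e f (r + 1)) := by
      simpa only [smul_smul] using hr'.const_smul (-(1 / 2) : ℝ)
    -- `U` is the derivative of F and `V` that of L⁻¹Γ_r. The 2 from differentiating a square
    -- cancels the 1/2 of L⁻¹, so -V has coefficients 2^r l_j^(r+1), and only the 2 in `U` passes to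
    -- the next power 2^(r+1).
    obtain ⟨U, hU⟩ := hW.exists_hasSum_selfSmul v.orthonormal (l := fun j => 2 * l j)
      (by simpa only [mul_pow] using hsq.summable.mul_left _)
    obtain ⟨V, hV⟩ := hW.exists_hasSum_selfSmul v.orthonormal
      (l := fun j => 2 * (-(1 / 2) * ((2 : ℝ) ^ r * l j ^ (r + 1))))
      (by simpa only [mul_pow] using
        (((hasSum_sq_of_hasSum_diag hr).summable.mul_left _).mul_left _).mul_left _)
    have hDF := hW.malliavinD_I₂ hl hU
    have hDG := hW.malliavinD_I₂ hr2 hV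
    have hV' : HasSum (fun j => ((2 : ℝ) ^ r * l j ^ (r + 1)) • hW.selfSmul (v j)) (-V) := by
      refine hV.neg.congr_fun fun j => ?_
      rw [← neg_smul]
      congr 1
      ring
    have hprod : ∀ j, (2 : ℝ) ^ (r + 1) * l j ^ (r + 2) =
        2 * l j * ((2 : ℝ) ^ r * l j ^ (r + 1)) := fun j => by ring
    have hf2 := hr1.const_smul ((2 : ℝ) ^ (r + 1))
    have hc2 := (summable_pow hsq r).hasSum.mul_left ((2 : ℝ) ^ (r + 1))
    simp only [smul_smul, hprod] at hf2 hc2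
    have hinner := hW.inner_hasSum_selfSmul v.orthonormal hU hV' hf2 hc2
    set c' := (2 : ℝ) ^ (r + 1) * ∑' j, l j ^ (r + 2)
    refine ⟨c', toL2_eq ?_⟩
    rw [hc, hW.Linv_I₂_add (Submodule.smul_mem _ _ (mem_symTensor_of_hasSum_diag hr)), ← map_smul,
      hDF, hDG]
    filter_upwards [hinner, Lp.coeFn_neg V, Lp.coeFn_add
      (hW.I₂ ((2 : ℝ) ^ (r + 1) • iterContraction e f (r + 1 + 1))) (c' • oneL2 P),
      Lp.coeFn_smul c' (oneL2 P), coeFn_oneL2 P] with ω h1 h2 h3 h4 h5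
    rw [h3, Pi.add_apply, h4, Pi.smul_apply, h5, smul_eq_mul, mul_one, ← h1, h2, Pi.neg_apply]

end IsIsonormal

end Wiener

namespace Wiener

/-! ### Each vanishing condition as a sum of `polyQ` over the spectrum. -/

section Kernel

variable {H : Type*} [NormedAddCommGroup H] [InnerProductSpace ℝ H] [CompleteSpace H]
  {J : Type*} {v : HilbertBasis J ℝ H} {l : J → ℝ} {f : HTensor H}

/-- Polynomial functional calculus: iterated contractions are operator powers. The constant
coefficient must vanish since the identity is not a kernel in infinite dimension. -/
lemma hasSum_diag_sum_iterContraction {ι : Type*} (e : HilbertBasis ι ℝ H)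
    (hf : HasSum (fun j => l j • pureTensor (v j) (v j)) f) {p : Polynomial ℝ}
    (hp : p.coeff 0 = 0) :
    HasSum (fun j => p.eval (l j) • pureTensor (v j) (v j))
      (∑ r ∈ Finset.Icc 1 p.natDegree, p.coeff r • iterContraction e f r) := by
  have h1 : ∀ r ∈ Finset.Icc 1 p.natDegree,
      HasSum (fun j => p.coeff r • (l j ^ r • pureTensor (v j) (v j)))
        (p.coeff r • iterContraction e f r) := by
    intro r hr
    obtain ⟨r, rfl⟩ := Nat.exists_eq_add_of_le' (Finset.mem_Icc.1 hr).1
    exact (hasSum_diag_iterContraction e hf r).const_smul _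
  refine (hasSum_sum h1).congr_fun fun j => ?_
  simp only [smul_smul, ← Finset.sum_smul]
  congr 1
  rw [Polynomial.eval_eq_sum_range, Finset.range_eq_Ico, Finset.sum_eq_sum_Ico_succ_bot (by omega),
    hp, zero_mul, zero_add]
  rfl

lemma norm_sq_sum_iterContraction {ι : Type*} (e : HilbertBasis ι ℝ H)
    (hf : HasSum (fun j => l j • pureTensor (v j) (v j)) f) {k : ℕ} (α : Fin k → ℝ) :
    ‖∑ r ∈ Finset.Icc 1 (polyP α).natDegree, taylorCoeff (polyP α) r • iterContraction e f r‖ ^ 2 =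
      ∑' j, (polyQ α).eval (l j) := by
  simp only [taylorCoeff_eq_coeff, polyQ, Polynomial.eval_pow]
  exact (hasSum_sq_of_hasSum_diag
    (hasSum_diag_sum_iterContraction e hf (coeff_zero_polyP α))).tsum_eq.symm

end Kernel

namespace IsIsonormal

variable {Ω : Type*} [MeasurableSpace Ω] {P : Measure Ω}
  {H : Type*} [NormedAddCommGroup H] [InnerProductSpace ℝ H] [CompleteSpace H] {W : H → Ω → ℝ}

/-- Double integrals have mean zero, so centring removes precisely the constant of `exists_Gam_eq`.
The remaining 2^r cancels the weight 2^(r-1) of the statement after the index shift. -/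
lemma Gam_sub_integral_ae_eq [IsProbabilityMeasure P] (hW : IsIsonormal W P) {ι : Type*}
    (e : HilbertBasis ι ℝ H) {f : HTensor H} (hf : f ∈ symTensor H) (r : ℕ) :
    (fun ω => Gam W P (hW.I₂ f) r ω - ∫ ω', Gam W P (hW.I₂ f) r ω' ∂P) =ᵐ[P]
      fun ω => 2 ^ r * hW.I₂ (iterContraction e f (r + 1)) ω := by
  obtain ⟨c, hc⟩ := hW.exists_Gam_eq e hf r
  have h1 : (Gam W P (hW.I₂ f) r : Ω → ℝ) =ᵐ[P]
      fun ω => 2 ^ r * hW.I₂ (iterContraction e f (r + 1)) ω + c := by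
    rw [hc, map_smul]
    filter_upwards [Lp.coeFn_add ((2 : ℝ) ^ r • hW.I₂ (iterContraction e f (r + 1)))
      (c • oneL2 P), Lp.coeFn_smul ((2 : ℝ) ^ r) (hW.I₂ (iterContraction e f (r + 1))),
      Lp.coeFn_smul c (oneL2 P), coeFn_oneL2 P] with ω h1 h2 h3 h4
    rw [h1, Pi.add_apply, h2, h3, Pi.smul_apply, Pi.smul_apply, h4]
    simp
  have h2 : ∫ ω, Gam W P (hW.I₂ f) r ω ∂P = c := by
    rw [integral_congr_ae h1, integral_add (((Lp.memLp _).integrable (by norm_num)).const_mul _)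
      (integrable_const _), integral_const_mul, hW.integral_I₂]
    simp
  filter_upwards [h1] with ω h
  rw [h2, h]
  ring

/-- The bracket equals I₂ of the kernel with eigenvalues P(l_j); the isometry gives twice the sum of
P(l_j)² = Q(l_j). -/
lemma integral_sum_Gam_sq [IsProbabilityMeasure P] (hW : IsIsonormal W P) {ι J : Type*}
    (e : HilbertBasis ι ℝ H) {v : HilbertBasis J ℝ H} {l : J → ℝ} {f : HTensor H}
    (hf : HasSum (fun j => l j • pureTensor (v j) (v j)) f) {k : ℕ} (α : Fin k → ℝ) :
    ∫ ω, (∑ r ∈ Finset.Icc 1 (k + 1), taylorCoeff (polyP α) r / 2 ^ (r - 1) *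
      (Gam W P (hW.I₂ f) (r - 1) ω - ∫ ω', Gam W P (hW.I₂ f) (r - 1) ω' ∂P)) ^ 2 ∂P =
      2 * ∑' j, (polyQ α).eval (l j) := by
  set g := ∑ r ∈ Finset.Icc 1 (polyP α).natDegree,
    taylorCoeff (polyP α) r • iterContraction e f r with hg
  have hgs : g ∈ symTensor H := by
    have := hasSum_diag_sum_iterContraction e hf (coeff_zero_polyP α)
    simp only [← taylorCoeff_eq_coeff] at this
    exact mem_symTensor_of_hasSum_diag this
  rw [← norm_sq_sum_iterContraction e hf α, ← hg, ← hW.norm_sq_I₂ hgs,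
    ← real_inner_self_eq_norm_sq, L2.inner_def]
  refine integral_congr_ae ?_
  have h1 : ∀ᵐ ω ∂P, ∀ r, Gam W P (hW.I₂ f) r ω - ∫ ω', Gam W P (hW.I₂ f) r ω' ∂P =
      2 ^ r * hW.I₂ (iterContraction e f (r + 1)) ω :=
    ae_all_iff.2 fun r => hW.Gam_sub_integral_ae_eq e (mem_symTensor_of_hasSum_diag hf) r
  have h2 : ∀ᵐ ω ∂P, ∀ r, (taylorCoeff (polyP α) r • hW.I₂ (iterContraction e f r) : Lp ℝ 2 P) ω =
      taylorCoeff (polyP α) r * hW.I₂ (iterContraction e f r) ω :=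
    ae_all_iff.2 fun r => Lp.coeFn_smul _ _
  have h3 : (hW.I₂ g : Ω → ℝ) =ᵐ[P] fun ω => ∑ r ∈ Finset.Icc 1 (k + 1),
      (taylorCoeff (polyP α) r • hW.I₂ (iterContraction e f r) : Lp ℝ 2 P) ω := by
    rw [hg, natDegree_polyP, map_sum]
    simp only [map_smul]
    exact Lp.coeFn_fun_finsetSum _ _
  filter_upwards [h1, h2, h3] with ω h1 h2 h3
  rw [h3]
  simp only [RCLike.inner_apply, conj_trivial, ← pow_two]
  congr 1
  refine Finset.sum_congr rfl fun r hr => ?_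
  obtain ⟨r, rfl⟩ := Nat.exists_eq_add_of_le' (Finset.mem_Icc.1 hr).1
  rw [h2, Nat.add_sub_cancel, h1]
  field_simp

lemma cumulant_I₂ (hW : IsIsonormal W P) {J : Type*} {v : HilbertBasis J ℝ H} {l : J → ℝ}
    {f : HTensor H} (hf : HasSum (fun j => l j • pureTensor (v j) (v j)) f) (r : ℕ) :
    cumulant P (r + 2) (hW.I₂ f) = 2 ^ (r + 1) * (r + 1).factorial * ∑' j, l j ^ (r + 2) :=
  have hl := hasSum_sq_of_hasSum_diag hf
  cumulant_eq_tsum_pow hl (hW.charFun_I₂ v.orthonormal hl hf) r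

lemma sum_coeff_mul_cumulant_I₂ (hW : IsIsonormal W P) {J : Type*} {v : HilbertBasis J ℝ H}
    {l : J → ℝ} {f : HTensor H} (hf : HasSum (fun j => l j • pureTensor (v j) (v j)) f)
    {k : ℕ} (α : Fin k → ℝ) :
    ∑ r ∈ Finset.Icc 2 (polyQ α).natDegree, taylorCoeff (polyQ α) r *
      (cumulant P r (hW.I₂ f) / (2 ^ (r - 1) * ((r - 1).factorial : ℝ))) =
      ∑' j, (polyQ α).eval (l j) := by
  rw [(hasSum_eval (hasSum_sq_of_hasSum_diag hf) (polyQ α) fun r => coeff_polyQ α).tsum_eq]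
  refine Finset.sum_congr rfl fun r hr => ?_
  obtain ⟨r, rfl⟩ := Nat.exists_eq_add_of_le' (Finset.mem_Icc.1 hr).1
  rw [taylorCoeff_eq_coeff, hW.cumulant_I₂ hf, show r + 2 - 1 = r + 1 from rfl,
    mul_div_cancel_left₀ _ (by positivity)]

end IsIsonormal

end Wiener

/-! ### The equivalence, reduced to spectra. -/

theorem propositionp
    {Ω : Type*} [MeasurableSpace Ω] (μ : Measure Ω) [IsProbabilityMeasure μ]
    {H : Type*} [NormedAddCommGroup H] [InnerProductSpace ℝ H] [CompleteSpace H]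
    [TopologicalSpace.SeparableSpace H]
    {ι : Type*} (e : HilbertBasis ι ℝ H)
    (W : H → Ω → ℝ) (hW : Wiener.IsIsonormal W μ)
    -- the target kernel: the non-zero eigenvalues of its operator are the `α i`, all simple
    (f_lim : Wiener.HTensor H) (hf_lim : f_lim ∈ Wiener.symTensor H)
    (k : ℕ) (α : Fin k → ℝ) (hα_inj : Function.Injective α)
    (hα : ∀ x : ℝ, (x ≠ 0 ∧ Module.End.HasEigenvalue (Wiener.kernelOp f_lim) x) ↔ ∃ i, α i = x)
    (hα_simple : ∀ i, Module.finrank ℝ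
      (Module.End.eigenspace (Wiener.kernelOp f_lim) (α i)) = 1)
    -- the sequence of kernels
    (f : ℕ → Wiener.HTensor H) (hf : ∀ n, f n ∈ Wiener.symTensor H) :
    List.TFAE [
      -- convergence in law
      TendstoInDistribution (fun n => (hW.I₂ (f n) : Ω → ℝ)) atTop (hW.I₂ f_lim : Ω → ℝ)
        (fun _ => μ) μ,
      -- cumulants, and the combination of cumulants with the coefficients of `Q`
      (∀ r : ℕ, 2 ≤ r → r ≤ k + 1 →
        Tendsto (fun n => Wiener.cumulant μ r (hW.I₂ (f n))) atTop
          (𝓝 (Wiener.cumulant μ r (hW.I₂ f_lim)))) ∧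
      Tendsto (fun n => ∑ r ∈ Finset.Icc 2 (Wiener.polyQ α).natDegree,
        Wiener.taylorCoeff (Wiener.polyQ α) r *
          (Wiener.cumulant μ r (hW.I₂ (f n)) / (2 ^ (r - 1) * ((r - 1).factorial : ℝ))))
        atTop (𝓝 0),
      -- cumulants, and the condition on the variables `Γ`
      (∀ r : ℕ, 2 ≤ r → r ≤ k + 1 →
        Tendsto (fun n => Wiener.cumulant μ r (hW.I₂ (f n))) atTop
          (𝓝 (Wiener.cumulant μ r (hW.I₂ f_lim)))) ∧
      Tendsto (fun n => ∫ ω, (∑ r ∈ Finset.Icc 1 (k + 1),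
        Wiener.taylorCoeff (Wiener.polyP α) r / 2 ^ (r - 1) *
          (Wiener.Gam W μ (hW.I₂ (f n)) (r - 1) ω
            - ∫ ω', Wiener.Gam W μ (hW.I₂ (f n)) (r - 1) ω' ∂μ)) ^ 2 ∂μ)
        atTop (𝓝 0),
      -- cumulants, and the condition on iterated contractions
      (∀ r : ℕ, 2 ≤ r → r ≤ k + 1 →
        Tendsto (fun n => Wiener.cumulant μ r (hW.I₂ (f n))) atTop
          (𝓝 (Wiener.cumulant μ r (hW.I₂ f_lim)))) ∧
      Tendsto (fun n => ‖∑ r ∈ Finset.Icc 1 (Wiener.polyP α).natDegree,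
        Wiener.taylorCoeff (Wiener.polyP α) r • Wiener.iterContraction e (f n) r‖ ^ 2)
        atTop (𝓝 0)] := by
  choose J v l hl using fun n => Wiener.exists_hasSum_diag (hf n)
  obtain ⟨J', v', l', hl'⟩ := Wiener.exists_hasSum_diag hf_lim
  have hα0 : ∀ i, α i ≠ 0 := fun i => ((hα (α i)).2 ⟨i, rfl⟩).1
  have hsq := fun n => Wiener.hasSum_sq_of_hasSum_diag (hl n)
  have hsq' := Wiener.hasSum_sq_of_hasSum_diag hl'
  -- The limiting spectrum consists of the α_i and zeros, so its sums of functions vanishing at 0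
  -- are finite sums over the α_i.
  have hpow' : ∀ r, ∑' j, l' j ^ (r + 2) = ∑ i, α i ^ (r + 2) := fun r =>
    (Wiener.hasSum_comp_eigenvalues hl' hα_inj hα hα_simple (fun x => x ^ (r + 2))
      (by simp)).tsum_eq
  have hpsi' : ∀ t : ℝ, ∑' j, Wiener.psi (t * l' j) = ∑ i, Wiener.psi (t * α i) := fun t => by
    simpa using (Wiener.hasSum_comp_eigenvalues hl' hα_inj hα hα_simple
      (fun x => Wiener.psi (t * x)) (by simp [Wiener.psi_zero])).tsum_eq
  have hlaw : TendstoInDistribution (fun n => (hW.I₂ (f n) : Ω → ℝ)) atTop (hW.I₂ f_lim : Ω → ℝ)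
      (fun _ => μ) μ ↔ ∀ t : ℝ, Tendsto (fun n => Complex.exp (∑' j, Wiener.psi (t * l n j))) atTop
        (𝓝 (Complex.exp (∑' j, Wiener.psi (t * l' j)))) := by
    rw [Wiener.tendstoInDistribution_iff_charFun
      (fun n => (Lp.aestronglyMeasurable _).aemeasurable)
      (Lp.aestronglyMeasurable _).aemeasurable]
    simp only [hW.charFun_I₂ v'.orthonormal hsq' hl',
      fun n => hW.charFun_I₂ (v n).orthonormal (hsq n) (hl n)]
  have hcum : (∀ r : ℕ, 2 ≤ r → r ≤ k + 1 →
      Tendsto (fun n => Wiener.cumulant μ r (hW.I₂ (f n))) atTop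
        (𝓝 (Wiener.cumulant μ r (hW.I₂ f_lim)))) ↔
      ∀ r < k, Tendsto (fun n => ∑' j, l n j ^ (r + 2)) atTop (𝓝 (∑ i, α i ^ (r + 2))) := by
    have h1 : ∀ r, Tendsto (fun n => Wiener.cumulant μ (r + 2) (hW.I₂ (f n))) atTop
        (𝓝 (Wiener.cumulant μ (r + 2) (hW.I₂ f_lim))) ↔
        Tendsto (fun n => ∑' j, l n j ^ (r + 2)) atTop (𝓝 (∑ i, α i ^ (r + 2))) := by
      intro r
      simp only [hW.cumulant_I₂ hl', fun n => hW.cumulant_I₂ (hl n), hpow']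
      have hne : (2 : ℝ) ^ (r + 1) * (r + 1).factorial ≠ 0 := by positivity
      refine ⟨fun h => ?_, fun h => h.const_mul _⟩
      simpa only [inv_mul_cancel_left₀ hne] using
        h.const_mul ((2 : ℝ) ^ (r + 1) * (r + 1).factorial)⁻¹
    refine ⟨fun h r hr => (h1 r).1 (h _ (by omega) (by omega)), fun h r hr hr' => ?_⟩
    obtain ⟨r, rfl⟩ := Nat.exists_eq_add_of_le' hr
    exact (h1 r).2 (h r (by omega))
  rw [hlaw, hcum]
  -- After this rewriting the last three statements differ only by the factor 2 in the one about Γ.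
  simp only [fun n => hW.sum_coeff_mul_cumulant_I₂ (hl n) α,
    fun n => hW.integral_sum_Gam_sq e (hl n) α,
    fun n => Wiener.norm_sq_sum_iterContraction e (hl n) α]
  tfae_have 1 → 2 := by
    intro h
    have hp := Wiener.tendsto_tsum_pow_of_tendsto_exp hsq hsq' h
    refine ⟨fun r _ => hpow' r ▸ hp r, ?_⟩
    have hQ := fun r (hr : r < 2) => Wiener.coeff_polyQ α hr
    simp only [fun n => (Wiener.hasSum_eval (hsq n) _ hQ).tsum_eq]
    -- The limit of ∑ Q(l_j) is the same combination of limiting power sums, which is zero because Q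
    -- vanishes at 0 and at each α_i.
    have h0 : ∑ r ∈ Finset.Icc 2 (Wiener.polyQ α).natDegree,
        (Wiener.polyQ α).coeff r * ∑' j, l' j ^ r = 0 := by
      rw [← (Wiener.hasSum_eval hsq' _ hQ).tsum_eq,
        (Wiener.hasSum_comp_eigenvalues hl' hα_inj hα hα_simple
          (fun x => (Wiener.polyQ α).eval x) (by simp [Wiener.eval_polyQ])).tsum_eq]
      exact Finset.sum_eq_zero fun i _ => Wiener.eval_polyQ_eq_zero α i
    rw [← h0]
    refine tendsto_finsetSum _ fun r hr => ?_
    obtain ⟨r, rfl⟩ := Nat.exists_eq_add_of_le' (Finset.mem_Icc.1 hr).1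
    exact (hp r).const_mul _
  tfae_have 2 → 1 := by
    rintro ⟨h, hQ⟩ t
    rw [hpsi']
    exact Wiener.tendsto_exp_of_tendsto_tsum_pow hsq hα_inj hα0 h hQ t
  tfae_have 2 ↔ 3 := by
    refine and_congr_right fun _ => ⟨fun h => by simpa using h.const_mul 2, fun h => ?_⟩
    simpa using h.const_mul (2 : ℝ)⁻¹
  tfae_have 2 ↔ 4 := Iff.rfl
  tfae_finish
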